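/- **Theorem.** Symmetric medial linearly distributive categories (0-cells), strong symmetric medial linear functors (1-cells) and strong medial linear transformations (2-cells), with the identities and compositions described below, form a (strict) 2-category $\mathbf{SMLDC}$. In particular, identities and composites of strong symmetric medial linear functors are again strong symmetric medial linear functors (including the coherences (SMLF.4)–(SMLF.6) below), and identities, vertical composites and horizontal composites of strong medial linear transformations are again such. Conventions. Composition is written $;$ in diagrammatic order, and all families of maps are natural in all their indices. A monoidal functor $(F,m_I,m)$ has coherent structure maps $m_I\colon I\to F(I)$, $m_{A,B}\colon F(A)\oslash F(B)\to F(A\oslash B)$; a comonoidal functor has coherent structure maps in the opposite direction; (co)monoidal transformations are natural transformations compatible with the structure maps. **0-cells.** A *symmetric medial linearly distributive category* (SMLDC) is a category with two symmetric monoidal structures $(\otimes,\top)$ and $(\oplus,\bot)$, with associators $\alpha_\otimes\colon (A\otimes B)\otimes C\to A\otimes(B\otimes C)$, $\alpha_\oplus\colon A\oplus(B\oplus C)\to(A\oplus B)\oplus C$, unitors $u^L_\otimes\colon A\to\top\otimes A$, $u^R_\otimes\colon A\to A\otimes\top$, $u^L_\oplus\colon\bot\oplus A\to A$, $u^R_\oplus\colon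 A\oplus\bot\to A$ and braidings $\sigma_\otimes,\sigma_\oplus$, together with maps $$\delta^R\colon(A\oplus B)\otimes C\to A\oplus(B\otimes C),\quad \delta^L\colon A\otimes(B\oplus C)\to(A\otimes B)\oplus C,$$ $$\Delta_\bot\colon\bot\to\bot\otimes\bot,\quad \nabla_\top\colon\top\oplus\top\to\top,\quad m\colon\bot\to\top,\quad \mu\colon(A\otimes B)\oplus(C\otimes D)\to(A\oplus C)\otimes(B\oplus D)$$ such that: 1. (linearly distributive) - $u^L_\otimes;\delta^L=u^L_\otimes\oplus1$, $u^R_\otimes;\delta^R=1\oplus u^R_\otimes$, $\delta^R;u^L_\oplus=u^L_\oplus\otimes1$, $\delta^L;u^R_\oplus=1\otimes u^R_\oplus$; - $\delta^L;(\alpha_\otimes\oplus1)=\alpha_\otimes;(1\otimes\delta^L);\delta^L$, $\ \alpha_\otimes;\delta^R=(\delta^R\otimes1);\delta^R;(1\oplus\alpha_\otimes)$, $\ \delta^L;\alpha_\oplus=(1\otimes\alpha_\oplus);\delta^L;(\delta^L\oplus1)$, $\ (\alpha_\oplus\otimes1);\delta^R=\delta^R;(1\oplus\delta^R);\alpha_\oplus$;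 - $\delta^L;(\delta^R\oplus1)=\delta^R;(1\oplus\delta^L);\alpha_\oplus$, $\ (\delta^L\otimes1);\delta^R=\alpha_\otimes;(1\otimes\delta^R);\delta^L$; - $\delta^R_{A,B,C}=\sigma_\otimes;(1\otimes\sigma_\oplus);\delta^L_{C,B,A};(\sigma_\otimes\oplus1);\sigma_\oplus$. 2. (mix) the two maps $A\otimes B\to A\oplus B$ obtained from $m$ agree: $(1\otimes (u^L_\oplus)^{-1});(1\otimes(m\oplus1));\delta^L;((u^R_\otimes)^{-1}\oplus1)=((u^R_\oplus)^{-1}\otimes1);((1\oplus m)\otimes1);\delta^R;(1\oplus(u^L_\otimes)^{-1})$. 3. (symmetric duoidal) $(\bot,\Delta_\bot,m)$ is a cocommutative $\otimes$-comonoid, $(\top,\nabla_\top,m)$ is a commutative $\oplus$-monoid, and - $\mu;(\mu\otimes1);\alpha_\otimes=(\alpha_\otimes\oplus\alpha_\otimes);\mu;(1\otimes\mu)$, $\ \alpha_\oplus;(\mu\oplus1);\mu=(1\oplus\mu);\mu;(\alpha_\oplus\otimes\alpha_\oplus)$; - $(\Delta_\bot\oplus1);\mu;(u^L_\oplus\otimes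 u^L_\oplus)=u^L_\oplus$, $\ (1\oplus\Delta_\bot);\mu;(u^R_\oplus\otimes u^R_\oplus)=u^R_\oplus$, $\ (u^L_\otimes\oplus u^L_\otimes);\mu;(\nabla_\top\otimes1)=u^L_\otimes$, $\ (u^R_\otimes\oplus u^R_\otimes);\mu;(1\otimes\nabla_\top)=u^R_\otimes$; - $\mu;\sigma_\otimes=(\sigma_\otimes\oplus\sigma_\otimes);\mu$, $\ \mu;(\sigma_\oplus\otimes\sigma_\oplus)=\sigma_\oplus;\mu$. 4. (medial maps and linear distributivities) - $(\mu\otimes1);\alpha_\otimes;(1\otimes\delta^R)=\delta^R;(1\oplus\alpha_\otimes);\mu$, $\ (1\otimes\mu);\alpha_\otimes^{-1};(\delta^L\otimes1)=\delta^L;(\alpha_\otimes^{-1}\oplus1);\mu$; - $(\delta^R\oplus1);\alpha_\oplus^{-1};(1\oplus\mu)=\mu;(\alpha_\oplus^{-1}\otimes1);\delta^R$, $\ (1\oplus\delta^L);\alpha_\oplus;(\mu\oplus1)=\mu;(1\otimes\alpha_\oplus);\delta^L$. **1-cells.** A *strong symmetric medial linear functor* $F\colon\mathbb X\to\mathbb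 Y$ consists of functors $F_\otimes,F_\oplus\colon\mathbb X\to\mathbb Y$ with - on $F_\otimes$, a strong symmetric monoidal structure $(m_\top,m_\otimes)$ for $\otimes$ and a symmetric monoidal structure $(m_\bot,m_\oplus)$ for $\oplus$; - on $F_\oplus$, a strong symmetric comonoidal structure $(n_\bot,n_\oplus)$ for $\oplus$ and a symmetric comonoidal structure $(n_\top,n_\otimes)$ for $\otimes$; - linear strengths $$\nu^R_\otimes\colon F_\otimes(A\oplus B)\to F_\oplus(A)\oplus F_\otimes(B),\quad \nu^L_\otimes\colon F_\otimes(A\oplus B)\to F_\otimes(A)\oplus F_\oplus(B),$$ $$\nu^R_\oplus\colon F_\otimes(A)\otimes F_\oplus(B)\to F_\oplus(A\otimes B),\quad \nu^L_\oplus\colon F_\oplus(A)\otimes F_\otimes(B)\to F_\oplus(A\otimes B),$$ such that: - (SMLF.1) $(F_\otimes,m_\bot,m_\oplus,m_\top^{-1},m_\otimes^{-1})$ is a bilax duoidal functor: $\Delta_\bot;(m_\bot\otimes m_\bot);m_\otimes=m_\bot;F_\otimes(\Delta_\bot)$, $\ (m_\top\oplus m_\top);m_\oplus;F_\otimes(\nabla_\top)=\nabla_\top;m_\top$,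 $\ m;m_\top=m_\bot;F_\otimes(m)$, $\ (m_\otimes\oplus m_\otimes);m_\oplus;F_\otimes(\mu)=\mu;(m_\oplus\otimes m_\oplus);m_\otimes$. - (SMLF.2) $(F_\oplus,n_\bot^{-1},n_\oplus^{-1},n_\top,n_\otimes)$ is a bilax duoidal functor: $F_\oplus(\Delta_\bot);n_\otimes;(n_\bot\otimes n_\bot)=n_\bot;\Delta_\bot$, $\ n_\oplus;(n_\top\oplus n_\top);\nabla_\top=F_\oplus(\nabla_\top);n_\top$, $\ n_\bot;m=F_\oplus(m);n_\top$, $\ F_\oplus(\mu);n_\otimes;(n_\oplus\otimes n_\oplus)=n_\oplus;(n_\otimes\oplus n_\otimes);\mu$. - (SMLF.3) $F$ is a symmetric linear functor: - $\nu^R_\otimes;(n_\bot\oplus1);u^L_\oplus=F_\otimes(u^L_\oplus)$, $\ \nu^L_\otimes;(1\oplus n_\bot);u^R_\oplus=F_\otimes(u^R_\oplus)$, $\ u^L_\otimes;(m_\top\otimes1);\nu^R_\oplus=F_\oplus(u^L_\otimes)$, $\ u^R_\otimes;(1\otimes m_\top);\nu^L_\oplus=F_\oplus(u^R_\otimes)$;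 - $\nu^R_\otimes;(1\oplus\nu^R_\otimes);\alpha_\oplus=F_\otimes(\alpha_\oplus);\nu^R_\otimes;(n_\oplus\oplus1)$, $\ \nu^L_\otimes;(1\oplus n_\oplus);\alpha_\oplus=F_\otimes(\alpha_\oplus);\nu^L_\otimes;(\nu^L_\otimes\oplus1)$, $\ \alpha_\otimes;(1\otimes\nu^R_\oplus);\nu^R_\oplus=(m_\otimes\otimes1);\nu^R_\oplus;F_\oplus(\alpha_\otimes)$, $\ \alpha_\otimes;(1\otimes m_\otimes);\nu^L_\oplus=(\nu^L_\oplus\otimes1);\nu^L_\oplus;F_\oplus(\alpha_\otimes)$; - $m_\otimes;F_\otimes(\delta^R);\nu^R_\otimes=(\nu^R_\otimes\otimes1);\delta^R;(1\oplus m_\otimes)$, $\ m_\otimes;F_\otimes(\delta^L);\nu^L_\otimes=(1\otimes\nu^L_\otimes);\delta^L;(m_\otimes\oplus1)$, $\ \nu^R_\oplus;F_\oplus(\delta^L);n_\oplus=(1\otimes n_\oplus);\delta^L;(\nu^R_\oplus\oplus1)$, $\ \nu^L_\oplus;F_\oplus(\delta^R);n_\oplus=(n_\oplus\otimes1);\delta^R;(1\oplus\nu^L_\oplus)$;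 - $\nu^R_\otimes;(1\oplus\nu^L_\otimes);\alpha_\oplus=F_\otimes(\alpha_\oplus);\nu^L_\otimes;(\nu^R_\otimes\oplus1)$, $\ \alpha_\otimes;(1\otimes\nu^L_\oplus);\nu^R_\oplus=(\nu^R_\oplus\otimes1);\nu^L_\oplus;F_\oplus(\alpha_\otimes)$; - $m_\otimes;F_\otimes(\delta^L);\nu^R_\otimes=(1\otimes\nu^R_\otimes);\delta^L;(\nu^R_\oplus\oplus1)$, $\ m_\otimes;F_\otimes(\delta^R);\nu^L_\otimes=(\nu^L_\otimes\otimes1);\delta^R;(1\oplus\nu^L_\oplus)$, $\ \nu^R_\oplus;F_\oplus(\delta^R);n_\oplus=(\nu^R_\otimes\otimes1);\delta^R;(1\oplus\nu^R_\oplus)$, $\ \nu^L_\oplus;F_\oplus(\delta^L);n_\oplus=(1\otimes\nu^L_\otimes);\delta^L;(\nu^L_\oplus\oplus1)$; - $\nu^R_\otimes;\sigma_\oplus=F_\otimes(\sigma_\oplus);\nu^L_\otimes$, $\ \nu^R_\oplus;F_\oplus(\sigma_\otimes)=\sigma_\otimes;\nu^L_\oplus$. - (SMLF.4) $F_\oplus(\Delta_\bot)=n_\bot;\Delta_\bot;(m_\bot\otimes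 n_\bot^{-1});\nu^R_\oplus$ and $F_\otimes(\nabla_\top)=\nu^R_\otimes;(n_\top\oplus m_\top^{-1});\nabla_\top;m_\top$. - (SMLF.5) $F_\otimes(\mu);m_\otimes^{-1};(\nu^R_\otimes\otimes\nu^R_\otimes)=\nu^R_\otimes;(n_\otimes\oplus m_\otimes^{-1});\mu$ and $(\nu^R_\oplus\oplus\nu^R_\oplus);n_\oplus^{-1};F_\oplus(\mu)=\mu;(m_\oplus\otimes n_\oplus^{-1});\nu^R_\oplus$. - (SMLF.6) $m_\oplus;F_\otimes(\alpha_\oplus^{-1});\nu^R_\otimes=(\nu^R_\otimes\oplus1);\alpha_\oplus^{-1};(1\oplus m_\oplus)$ and $\nu^R_\oplus;F_\oplus(\alpha_\otimes^{-1});n_\otimes=(1\otimes n_\otimes);\alpha_\otimes^{-1};(\nu^R_\oplus\otimes1)$. The identity 1-cell is the pair of identity functors with identity structure maps. The composite of $F$ and $G$ is $(F_\otimes;G_\otimes,F_\oplus;G_\oplus)$ with the composite (co)monoidal structures and the strengths $G_\otimes(\nu^{F}_\otimes);\nu^{G}_\otimes$ and $\nu^{G}_\oplus;G_\oplus(\nu^{F}_\oplus)$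 (for both $R$ and $L$). **2-cells.** A *strong medial linear transformation* $\alpha\colon F\Rightarrow G$ is a pair of natural transformations $\alpha_\otimes\colon F_\otimes\Rightarrow G_\otimes$, $\alpha_\oplus\colon G_\oplus\Rightarrow F_\oplus$ such that $\alpha_\otimes$ is a monoidal transformation for $(m_\top,m_\otimes)$ and for $(m_\bot,m_\oplus)$, $\alpha_\oplus$ is a comonoidal transformation for $(n_\bot,n_\oplus)$ and for $(n_\top,n_\otimes)$, and $$\alpha_\otimes;\nu^{R,G}_\otimes;(\alpha_\oplus\oplus1)=\nu^{R,F}_\otimes;(1\oplus\alpha_\otimes),\qquad \alpha_\otimes;\nu^{L,G}_\otimes;(1\oplus\alpha_\oplus)=\nu^{L,F}_\otimes;(\alpha_\otimes\oplus1),$$ $$(1\otimes\alpha_\otimes);\nu^{L,G}_\oplus;\alpha_\oplus=(\alpha_\oplus\otimes1);\nu^{L,F}_\oplus,\qquad (\alpha_\otimes\otimes1);\nu^{R,G}_\oplus;\alpha_\oplus=(1\otimes\alpha_\oplus);\nu^{R,F}_\oplus.$$ Identities are pairs of identities; vertical composition is $(\alpha_\otimes;\beta_\otimes,\ \beta_\oplus;\alpha_\oplus)$,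 and horizontal composition is the usual horizontal composition of natural transformations in both components. -/

import Mathlib

open CategoryTheory

universe v u

namespace MedialLD

/-! ### Categories with two monoidal structures

The tensor structure is `(⊗ₒ, top)` and the par structure is `(⊕ₒ, bot)`; the action of the two
products on maps is written `⊗ₕ` and `⊕ₕ`. -/

/-- A category with a tensor and a par monoidal structure. -/
class TwoMonoidal (X : Type u) [Category.{v} X] where
  /-- the tensor monoidal structure -/
  ten : MonoidalCategory X
  /-- the par monoidal structure -/
  par : MonoidalCategory X

section TwoMonoidal

variable (X : Type u) [Category.{v} X] [TwoMonoidal X]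

/-- The unit of the tensor. -/
abbrev top : X := (TwoMonoidal.ten (X := X)).tensorUnit

/-- The unit of the par. -/
abbrev bot : X := (TwoMonoidal.par (X := X)).tensorUnit

variable {X}

/-- The tensor of two objects. -/
abbrev tObj (A B : X) : X := (TwoMonoidal.ten (X := X)).tensorObj A B

/-- The par of two objects. -/
abbrev pObj (A B : X) : X := (TwoMonoidal.par (X := X)).tensorObj A B

infixr:70 " ⊗ₒ " => tObj
infixr:65 " ⊕ₒ " => pObj

/-- The tensor of two maps. -/
abbrev tHom {A B C D : X} (f : A ⟶ B) (g : C ⟶ D) : A ⊗ₒ C ⟶ B ⊗ₒ D :=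
  (TwoMonoidal.ten (X := X)).tensorHom f g

/-- The par of two maps. -/
abbrev pHom {A B C D : X} (f : A ⟶ B) (g : C ⟶ D) : A ⊕ₒ C ⟶ B ⊕ₒ D :=
  (TwoMonoidal.par (X := X)).tensorHom f g

infixr:81 " ⊗ₕ " => tHom
infixr:81 " ⊕ₕ " => pHom

/-- `α_⊗ : (A ⊗ B) ⊗ C ≅ A ⊗ (B ⊗ C)`. -/
abbrev tAssoc (A B C : X) : (A ⊗ₒ B) ⊗ₒ C ≅ A ⊗ₒ (B ⊗ₒ C) :=
  (TwoMonoidal.ten (X := X)).associator A B C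

/-- `α_⊕ : A ⊕ (B ⊕ C) ≅ (A ⊕ B) ⊕ C`. -/
abbrev pAssoc (A B C : X) : A ⊕ₒ (B ⊕ₒ C) ≅ (A ⊕ₒ B) ⊕ₒ C :=
  ((TwoMonoidal.par (X := X)).associator A B C).symm

/-- `u^L_⊗ : A ≅ ⊤ ⊗ A`. -/
abbrev tL (A : X) : A ≅ top X ⊗ₒ A := ((TwoMonoidal.ten (X := X)).leftUnitor A).symm

/-- `u^R_⊗ : A ≅ A ⊗ ⊤`. -/
abbrev tR (A : X) : A ≅ A ⊗ₒ top X := ((TwoMonoidal.ten (X := X)).rightUnitor A).symm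

/-- `u^L_⊕ : ⊥ ⊕ A ≅ A`. -/
abbrev pL (A : X) : bot X ⊕ₒ A ≅ A := (TwoMonoidal.par (X := X)).leftUnitor A

/-- `u^R_⊕ : A ⊕ ⊥ ≅ A`. -/
abbrev pR (A : X) : A ⊕ₒ bot X ≅ A := (TwoMonoidal.par (X := X)).rightUnitor A

end TwoMonoidal

/-! ### Linearly distributive categories -/

/-- A linearly distributive category. -/
class LDC (X : Type u) [Category.{v} X] extends TwoMonoidal X where
  /-- the right linear distributivity -/
  δR (A B C : X) : (A ⊕ₒ B) ⊗ₒ C ⟶ A ⊕ₒ (B ⊗ₒ C)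
  /-- the left linear distributivity -/
  δL (A B C : X) : A ⊗ₒ (B ⊕ₒ C) ⟶ (A ⊗ₒ B) ⊕ₒ C
  δR_natural {A A' B B' C C' : X} (f : A ⟶ A') (g : B ⟶ B') (h : C ⟶ C') :
    ((f ⊕ₕ g) ⊗ₕ h) ≫ δR A' B' C' = δR A B C ≫ (f ⊕ₕ (g ⊗ₕ h))
  δL_natural {A A' B B' C C' : X} (f : A ⟶ A') (g : B ⟶ B') (h : C ⟶ C') :
    (f ⊗ₕ (g ⊕ₕ h)) ≫ δL A' B' C' = δL A B C ≫ ((f ⊗ₕ g) ⊕ₕ h)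
  -- units and linear distributivities
  tL_δL (A B : X) : (tL (A ⊕ₒ B)).hom ≫ δL (top X) A B = (tL A).hom ⊕ₕ 𝟙 B
  tR_δR (A B : X) : (tR (A ⊕ₒ B)).hom ≫ δR A B (top X) = 𝟙 A ⊕ₕ (tR B).hom
  δR_pL (A B : X) : δR (bot X) A B ≫ (pL (A ⊗ₒ B)).hom = (pL A).hom ⊗ₕ 𝟙 B
  δL_pR (A B : X) : δL A B (bot X) ≫ (pR (A ⊗ₒ B)).hom = 𝟙 A ⊗ₕ (pR B).hom
  -- associativities and linear distributivities
  δL_tAssoc (A B C D : X) :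
    δL (A ⊗ₒ B) C D ≫ ((tAssoc A B C).hom ⊕ₕ 𝟙 D) =
      (tAssoc A B (C ⊕ₒ D)).hom ≫ (𝟙 A ⊗ₕ δL B C D) ≫ δL A (B ⊗ₒ C) D
  δR_tAssoc (A B C D : X) :
    (tAssoc (A ⊕ₒ B) C D).hom ≫ δR A B (C ⊗ₒ D) =
      (δR A B C ⊗ₕ 𝟙 D) ≫ δR A (B ⊗ₒ C) D ≫ (𝟙 A ⊕ₕ (tAssoc B C D).hom)
  δL_pAssoc (A B C D : X) :
    δL A B (C ⊕ₒ D) ≫ (pAssoc (A ⊗ₒ B) C D).hom =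
      (𝟙 A ⊗ₕ (pAssoc B C D).hom) ≫ δL A (B ⊕ₒ C) D ≫ (δL A B C ⊕ₕ 𝟙 D)
  δR_pAssoc (A B C D : X) :
    ((pAssoc A B C).hom ⊗ₕ 𝟙 D) ≫ δR (A ⊕ₒ B) C D =
      δR A (B ⊕ₒ C) D ≫ (𝟙 A ⊕ₕ δR B C D) ≫ (pAssoc A B (C ⊗ₒ D)).hom
  -- left and right linear distributivities
  δL_δR (A B C D : X) :
    δL (A ⊕ₒ B) C D ≫ (δR A B C ⊕ₕ 𝟙 D) =
      δR A B (C ⊕ₒ D) ≫ (𝟙 A ⊕ₕ δL B C D) ≫ (pAssoc A (B ⊗ₒ C) D).hom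
  δR_δL (A B C D : X) :
    (δL A B C ⊗ₕ 𝟙 D) ≫ δR (A ⊗ₒ B) C D =
      (tAssoc A (B ⊕ₒ C) D).hom ≫ (𝟙 A ⊗ₕ δR B C D) ≫ δL A B (C ⊗ₒ D)

/-! ### Medial linearly distributive categories -/

/-- A medial linearly distributive category: a mix LDC `(X, ⊗, ⊤, ⊕, ⊥)` such that
`(X, ⊕, ⊥, ⊗, ⊤)` is a duoidal category, the two structures interacting coherently. -/
class MLDC (X : Type u) [Category.{v} X] extends LDC X where
  /-- `⊥`-contraction -/
  Δbot : bot X ⟶ bot X ⊗ₒ bot X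
  /-- `⊤`-cocontraction -/
  nablaTop : top X ⊕ₒ top X ⟶ top X
  /-- the nullary mix map -/
  mix : bot X ⟶ top X
  /-- the medial maps -/
  μ (A B C D : X) : (A ⊗ₒ B) ⊕ₒ (C ⊗ₒ D) ⟶ (A ⊕ₒ C) ⊗ₒ (B ⊕ₒ D)
  μ_natural {A A' B B' C C' D D' : X} (f : A ⟶ A') (g : B ⟶ B') (h : C ⟶ C') (k : D ⟶ D') :
    ((f ⊗ₕ g) ⊕ₕ (h ⊗ₕ k)) ≫ μ A' B' C' D' = μ A B C D ≫ ((f ⊕ₕ h) ⊗ₕ (g ⊕ₕ k))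
  -- the LDC is mix
  mix_coherence (A B : X) :
    (𝟙 A ⊗ₕ (pL B).inv) ≫ (𝟙 A ⊗ₕ (mix ⊕ₕ 𝟙 B)) ≫ δL A (top X) B ≫ ((tR A).inv ⊕ₕ 𝟙 B) =
      ((pR A).inv ⊗ₕ 𝟙 B) ≫ ((𝟙 A ⊕ₕ mix) ⊗ₕ 𝟙 B) ≫ δR A (top X) B ≫ (𝟙 A ⊕ₕ (tL B).inv)
  -- `(⊥, Δbot, mix)` is a `⊗`-comonoid
  Δbot_coassoc :
    Δbot ≫ (𝟙 (bot X) ⊗ₕ Δbot) = Δbot ≫ (Δbot ⊗ₕ 𝟙 (bot X)) ≫ (tAssoc _ _ _).hom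
  Δbot_mix_right : Δbot ≫ (𝟙 (bot X) ⊗ₕ mix) = (tR (bot X)).hom
  Δbot_mix_left : Δbot ≫ (mix ⊗ₕ 𝟙 (bot X)) = (tL (bot X)).hom
  -- `(⊤, nablaTop, mix)` is a `⊕`-monoid
  nablaTop_assoc :
    (𝟙 (top X) ⊕ₕ nablaTop) ≫ nablaTop =
      (pAssoc _ _ _).hom ≫ (nablaTop ⊕ₕ 𝟙 (top X)) ≫ nablaTop
  mix_nablaTop_right : (𝟙 (top X) ⊕ₕ mix) ≫ nablaTop = (pR (top X)).hom
  mix_nablaTop_left : (mix ⊕ₕ 𝟙 (top X)) ≫ nablaTop = (pL (top X)).hom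
  -- medial maps and associators
  μ_tAssoc (A B C D E F : X) :
    μ (A ⊗ₒ B) C (D ⊗ₒ E) F ≫ (μ A B D E ⊗ₕ 𝟙 (C ⊕ₒ F)) ≫
        (tAssoc (A ⊕ₒ D) (B ⊕ₒ E) (C ⊕ₒ F)).hom =
      ((tAssoc A B C).hom ⊕ₕ (tAssoc D E F).hom) ≫ μ A (B ⊗ₒ C) D (E ⊗ₒ F) ≫
        (𝟙 (A ⊕ₒ D) ⊗ₕ μ B C E F)
  μ_pAssoc (A B C D E F : X) :
    (pAssoc (A ⊗ₒ B) (C ⊗ₒ D) (E ⊗ₒ F)).hom ≫ (μ A B C D ⊕ₕ 𝟙 (E ⊗ₒ F)) ≫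
        μ (A ⊕ₒ C) (B ⊕ₒ D) E F =
      (𝟙 (A ⊗ₒ B) ⊕ₕ μ C D E F) ≫ μ A B (C ⊕ₒ E) (D ⊕ₒ F) ≫
        ((pAssoc A C E).hom ⊗ₕ (pAssoc B D F).hom)
  -- medial maps and unitors
  μ_pL (A B : X) :
    (Δbot ⊕ₕ 𝟙 (A ⊗ₒ B)) ≫ μ (bot X) (bot X) A B ≫ ((pL A).hom ⊗ₕ (pL B).hom) =
      (pL (A ⊗ₒ B)).hom
  μ_pR (A B : X) :
    (𝟙 (A ⊗ₒ B) ⊕ₕ Δbot) ≫ μ A B (bot X) (bot X) ≫ ((pR A).hom ⊗ₕ (pR B).hom) =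
      (pR (A ⊗ₒ B)).hom
  μ_tL (A B : X) :
    ((tL A).hom ⊕ₕ (tL B).hom) ≫ μ (top X) A (top X) B ≫ (nablaTop ⊗ₕ 𝟙 (A ⊕ₒ B)) =
      (tL (A ⊕ₒ B)).hom
  μ_tR (A B : X) :
    ((tR A).hom ⊕ₕ (tR B).hom) ≫ μ A (top X) B (top X) ≫ (𝟙 (A ⊕ₒ B) ⊗ₕ nablaTop) =
      (tR (A ⊕ₒ B)).hom
  -- medial maps and linear distributivities
  μ_δR_ten (A B C D Z : X) :
    (μ A B C D ⊗ₕ 𝟙 Z) ≫ (tAssoc (A ⊕ₒ C) (B ⊕ₒ D) Z).hom ≫ (𝟙 (A ⊕ₒ C) ⊗ₕ δR B D Z) =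
      δR (A ⊗ₒ B) (C ⊗ₒ D) Z ≫ (𝟙 (A ⊗ₒ B) ⊕ₕ (tAssoc C D Z).hom) ≫ μ A B C (D ⊗ₒ Z)
  μ_δL_ten (A B C D Z : X) :
    (𝟙 Z ⊗ₕ μ A B C D) ≫ (tAssoc Z (A ⊕ₒ C) (B ⊕ₒ D)).inv ≫ (δL Z A C ⊗ₕ 𝟙 (B ⊕ₒ D)) =
      δL Z (A ⊗ₒ B) (C ⊗ₒ D) ≫ ((tAssoc Z A B).inv ⊕ₕ 𝟙 (C ⊗ₒ D)) ≫ μ (Z ⊗ₒ A) B C D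
  μ_δR_par (A B C D Z : X) :
    (δR Z A B ⊕ₕ 𝟙 (C ⊗ₒ D)) ≫ (pAssoc Z (A ⊗ₒ B) (C ⊗ₒ D)).inv ≫ (𝟙 Z ⊕ₕ μ A B C D) =
      μ (Z ⊕ₒ A) B C D ≫ ((pAssoc Z A C).inv ⊗ₕ 𝟙 (B ⊕ₒ D)) ≫ δR Z (A ⊕ₒ C) (B ⊕ₒ D)
  μ_δL_par (A B C D Z : X) :
    (𝟙 (A ⊗ₒ B) ⊕ₕ δL C D Z) ≫ (pAssoc (A ⊗ₒ B) (C ⊗ₒ D) Z).hom ≫ (μ A B C D ⊕ₕ 𝟙 Z) =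
      μ A B C (D ⊕ₒ Z) ≫ (𝟙 (A ⊕ₒ C) ⊗ₕ (pAssoc B D Z).hom) ≫ δL (A ⊕ₒ C) (B ⊕ₒ D) Z

/-- A symmetric medial linearly distributive category. -/
class SymmetricMLDC (X : Type u) [Category.{v} X] extends MLDC X where
  /-- the symmetry of the tensor -/
  tSymm : @SymmetricCategory X _ ten
  /-- the symmetry of the par -/
  pSymm : @SymmetricCategory X _ par
  -- braidings and linear distributivities
  δR_braiding (A B C : X) :
    δR A B C =
      (tSymm.braiding (A ⊕ₒ B) C).hom ≫ (𝟙 C ⊗ₕ (pSymm.braiding A B).hom) ≫ δL C B A ≫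
        ((tSymm.braiding C B).hom ⊕ₕ 𝟙 A) ≫ (pSymm.braiding (B ⊗ₒ C) A).hom
  -- `⊥` is cocommutative, `⊤` is commutative
  Δbot_comm : Δbot ≫ (tSymm.braiding (bot X) (bot X)).hom = Δbot
  nablaTop_comm : (pSymm.braiding (top X) (top X)).hom ≫ nablaTop = nablaTop
  -- braidings and medial maps
  μ_tBraiding (A B C D : X) :
    μ A B C D ≫ (tSymm.braiding (A ⊕ₒ C) (B ⊕ₒ D)).hom =
      ((tSymm.braiding A B).hom ⊕ₕ (tSymm.braiding C D).hom) ≫ μ B A D C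
  μ_pBraiding (A B C D : X) :
    μ A B C D ≫ ((pSymm.braiding A C).hom ⊗ₕ (pSymm.braiding B D).hom) =
      (pSymm.braiding (A ⊗ₒ B) (C ⊗ₒ D)).hom ≫ μ C D A B

/-- `σ_⊗`. -/
abbrev tBraid {X : Type u} [Category.{v} X] [SymmetricMLDC X] (A B : X) : A ⊗ₒ B ≅ B ⊗ₒ A :=
  (SymmetricMLDC.tSymm (X := X)).braiding A B

/-- `σ_⊕`. -/
abbrev pBraid {X : Type u} [Category.{v} X] [SymmetricMLDC X] (A B : X) : A ⊕ₒ B ≅ B ⊕ₒ A :=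
  (SymmetricMLDC.pSymm (X := X)).braiding A B

open LDC MLDC

/-! ### Linear functors -/

section Functors

variable (X : Type u) [Category.{v} X] (Y : Type u) [Category.{v} Y]

/-- The data of a linear functor `(F_⊗, F_⊕)`: a monoidal functor for the tensors, a comonoidal
functor for the pars, and four families of linear strengths. -/
structure LinearFunctorData [LDC X] [LDC Y] where
  /-- the functor `F_⊗` -/
  Ft : X ⥤ Y
  /-- the functor `F_⊕` -/
  Fp : X ⥤ Y
  /-- the monoidal structure `(m_⊤, m_⊗)` of `F_⊗` -/
  tLax : @Functor.LaxMonoidal X _ TwoMonoidal.ten Y _ TwoMonoidal.ten Ft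
  /-- the comonoidal structure `(n_⊥, n_⊕)` of `F_⊕` -/
  pOplax : @Functor.OplaxMonoidal X _ TwoMonoidal.par Y _ TwoMonoidal.par Fp
  /-- `ν^R_⊗` -/
  νtR (A B : X) : Ft.obj (A ⊕ₒ B) ⟶ Fp.obj A ⊕ₒ Ft.obj B
  /-- `ν^L_⊗` -/
  νtL (A B : X) : Ft.obj (A ⊕ₒ B) ⟶ Ft.obj A ⊕ₒ Fp.obj B
  /-- `ν^R_⊕` -/
  νpR (A B : X) : Ft.obj A ⊗ₒ Fp.obj B ⟶ Fp.obj (A ⊗ₒ B)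
  /-- `ν^L_⊕` -/
  νpL (A B : X) : Fp.obj A ⊗ₒ Ft.obj B ⟶ Fp.obj (A ⊗ₒ B)

/-- The data of a medial linear functor: in addition, `F_⊗` is a monoidal functor for the pars and
`F_⊕` is a comonoidal functor for the tensors. -/
structure MedialFunctorData [LDC X] [LDC Y] extends LinearFunctorData X Y where
  /-- the monoidal structure `(m_⊥, m_⊕)` of `F_⊗` -/
  pLax : @Functor.LaxMonoidal X _ TwoMonoidal.par Y _ TwoMonoidal.par Ft
  /-- the comonoidal structure `(n_⊤, n_⊗)` of `F_⊕` -/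
  tOplax : @Functor.OplaxMonoidal X _ TwoMonoidal.ten Y _ TwoMonoidal.ten Fp

variable {X Y}

namespace LinearFunctorData

variable [LDC X] [LDC Y] (F : LinearFunctorData X Y)

/-- `m_⊤`. -/
abbrev mTop : top Y ⟶ F.Ft.obj (top X) := F.tLax.ε

/-- `m_⊗`. -/
abbrev mTen (A B : X) : F.Ft.obj A ⊗ₒ F.Ft.obj B ⟶ F.Ft.obj (A ⊗ₒ B) := F.tLax.μ A B

/-- `n_⊥`. -/
abbrev nBot : F.Fp.obj (bot X) ⟶ bot Y := F.pOplax.η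

/-- `n_⊕`. -/
abbrev nPar (A B : X) : F.Fp.obj (A ⊕ₒ B) ⟶ F.Fp.obj A ⊕ₒ F.Fp.obj B := F.pOplax.δ A B

/-- The data form a linear functor: the linear strengths are natural and coherent. -/
structure IsLinear : Prop where
  -- naturality of the linear strengths
  νtR_natural {A A' B B' : X} (f : A ⟶ A') (g : B ⟶ B') :
    F.Ft.map (f ⊕ₕ g) ≫ F.νtR A' B' = F.νtR A B ≫ (F.Fp.map f ⊕ₕ F.Ft.map g)
  νtL_natural {A A' B B' : X} (f : A ⟶ A') (g : B ⟶ B') :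
    F.Ft.map (f ⊕ₕ g) ≫ F.νtL A' B' = F.νtL A B ≫ (F.Ft.map f ⊕ₕ F.Fp.map g)
  νpR_natural {A A' B B' : X} (f : A ⟶ A') (g : B ⟶ B') :
    (F.Ft.map f ⊗ₕ F.Fp.map g) ≫ F.νpR A' B' = F.νpR A B ≫ F.Fp.map (f ⊗ₕ g)
  νpL_natural {A A' B B' : X} (f : A ⟶ A') (g : B ⟶ B') :
    (F.Fp.map f ⊗ₕ F.Ft.map g) ≫ F.νpL A' B' = F.νpL A B ≫ F.Fp.map (f ⊗ₕ g)
  -- units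
  νtR_unit (A : X) :
    F.νtR (bot X) A ≫ (F.nBot ⊕ₕ 𝟙 (F.Ft.obj A)) ≫ (pL (F.Ft.obj A)).hom = F.Ft.map (pL A).hom
  νtL_unit (A : X) :
    F.νtL A (bot X) ≫ (𝟙 (F.Ft.obj A) ⊕ₕ F.nBot) ≫ (pR (F.Ft.obj A)).hom = F.Ft.map (pR A).hom
  νpR_unit (A : X) :
    (tL (F.Fp.obj A)).hom ≫ (F.mTop ⊗ₕ 𝟙 (F.Fp.obj A)) ≫ F.νpR (top X) A = F.Fp.map (tL A).hom
  νpL_unit (A : X) :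
    (tR (F.Fp.obj A)).hom ≫ (𝟙 (F.Fp.obj A) ⊗ₕ F.mTop) ≫ F.νpL A (top X) = F.Fp.map (tR A).hom
  -- associativities
  νtR_assoc (A B C : X) :
    F.νtR A (B ⊕ₒ C) ≫ (𝟙 (F.Fp.obj A) ⊕ₕ F.νtR B C) ≫ (pAssoc _ _ _).hom =
      F.Ft.map (pAssoc A B C).hom ≫ F.νtR (A ⊕ₒ B) C ≫ (F.nPar A B ⊕ₕ 𝟙 (F.Ft.obj C))
  νtL_assoc (A B C : X) :
    F.νtL A (B ⊕ₒ C) ≫ (𝟙 (F.Ft.obj A) ⊕ₕ F.nPar B C) ≫ (pAssoc _ _ _).hom =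
      F.Ft.map (pAssoc A B C).hom ≫ F.νtL (A ⊕ₒ B) C ≫ (F.νtL A B ⊕ₕ 𝟙 (F.Fp.obj C))
  νpR_assoc (A B C : X) :
    (tAssoc _ _ _).hom ≫ (𝟙 (F.Ft.obj A) ⊗ₕ F.νpR B C) ≫ F.νpR A (B ⊗ₒ C) =
      (F.mTen A B ⊗ₕ 𝟙 (F.Fp.obj C)) ≫ F.νpR (A ⊗ₒ B) C ≫ F.Fp.map (tAssoc A B C).hom
  νpL_assoc (A B C : X) :
    (tAssoc _ _ _).hom ≫ (𝟙 (F.Fp.obj A) ⊗ₕ F.mTen B C) ≫ F.νpL A (B ⊗ₒ C) =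
      (F.νpL A B ⊗ₕ 𝟙 (F.Ft.obj C)) ≫ F.νpL (A ⊗ₒ B) C ≫ F.Fp.map (tAssoc A B C).hom
  -- linear distributivities
  νtR_δR (A B C : X) :
    F.mTen (A ⊕ₒ B) C ≫ F.Ft.map (δR A B C) ≫ F.νtR A (B ⊗ₒ C) =
      (F.νtR A B ⊗ₕ 𝟙 (F.Ft.obj C)) ≫ δR _ _ _ ≫ (𝟙 (F.Fp.obj A) ⊕ₕ F.mTen B C)
  νtL_δL (A B C : X) :
    F.mTen A (B ⊕ₒ C) ≫ F.Ft.map (δL A B C) ≫ F.νtL (A ⊗ₒ B) C =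
      (𝟙 (F.Ft.obj A) ⊗ₕ F.νtL B C) ≫ δL _ _ _ ≫ (F.mTen A B ⊕ₕ 𝟙 (F.Fp.obj C))
  νpR_δL (A B C : X) :
    F.νpR A (B ⊕ₒ C) ≫ F.Fp.map (δL A B C) ≫ F.nPar (A ⊗ₒ B) C =
      (𝟙 (F.Ft.obj A) ⊗ₕ F.nPar B C) ≫ δL _ _ _ ≫ (F.νpR A B ⊕ₕ 𝟙 (F.Fp.obj C))
  νpL_δR (A B C : X) :
    F.νpL (A ⊕ₒ B) C ≫ F.Fp.map (δR A B C) ≫ F.nPar A (B ⊗ₒ C) =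
      (F.nPar A B ⊗ₕ 𝟙 (F.Ft.obj C)) ≫ δR _ _ _ ≫ (𝟙 (F.Fp.obj A) ⊕ₕ F.νpL B C)
  -- the other linear strengths via associators
  νtR_νtL (A B C : X) :
    F.νtR A (B ⊕ₒ C) ≫ (𝟙 (F.Fp.obj A) ⊕ₕ F.νtL B C) ≫ (pAssoc _ _ _).hom =
      F.Ft.map (pAssoc A B C).hom ≫ F.νtL (A ⊕ₒ B) C ≫ (F.νtR A B ⊕ₕ 𝟙 (F.Fp.obj C))
  νpL_νpR (A B C : X) :
    (tAssoc _ _ _).hom ≫ (𝟙 (F.Ft.obj A) ⊗ₕ F.νpL B C) ≫ F.νpR A (B ⊗ₒ C) =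
      (F.νpR A B ⊗ₕ 𝟙 (F.Ft.obj C)) ≫ F.νpL (A ⊗ₒ B) C ≫ F.Fp.map (tAssoc A B C).hom
  -- the other linear strengths via linear distributivities
  νtR_δL (A B C : X) :
    F.mTen A (B ⊕ₒ C) ≫ F.Ft.map (δL A B C) ≫ F.νtR (A ⊗ₒ B) C =
      (𝟙 (F.Ft.obj A) ⊗ₕ F.νtR B C) ≫ δL _ _ _ ≫ (F.νpR A B ⊕ₕ 𝟙 (F.Ft.obj C))
  νtL_δR (A B C : X) :
    F.mTen (A ⊕ₒ B) C ≫ F.Ft.map (δR A B C) ≫ F.νtL A (B ⊗ₒ C) =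
      (F.νtL A B ⊗ₕ 𝟙 (F.Ft.obj C)) ≫ δR _ _ _ ≫ (𝟙 (F.Ft.obj A) ⊕ₕ F.νpL B C)
  νpR_δR (A B C : X) :
    F.νpR (A ⊕ₒ B) C ≫ F.Fp.map (δR A B C) ≫ F.nPar A (B ⊗ₒ C) =
      (F.νtR A B ⊗ₕ 𝟙 (F.Fp.obj C)) ≫ δR _ _ _ ≫ (𝟙 (F.Fp.obj A) ⊕ₕ F.νpR B C)
  νpL_δL (A B C : X) :
    F.νpL A (B ⊕ₒ C) ≫ F.Fp.map (δL A B C) ≫ F.nPar (A ⊗ₒ B) C =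
      (𝟙 (F.Fp.obj A) ⊗ₕ F.νtL B C) ≫ δL _ _ _ ≫ (F.νpL A B ⊕ₕ 𝟙 (F.Fp.obj C))

end LinearFunctorData

/-- The data form a symmetric linear functor (on top of `IsLinear`): the (co)monoidal functors are
symmetric and the linear strengths are compatible with the braidings. -/
structure LinearFunctorData.IsSymmetric [SymmetricMLDC X] [SymmetricMLDC Y]
    (F : LinearFunctorData X Y) : Prop where
  mTen_braid (A B : X) :
    F.mTen A B ≫ F.Ft.map (tBraid A B).hom = (tBraid _ _).hom ≫ F.mTen B A
  nPar_braid (A B : X) :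
    F.Fp.map (pBraid A B).hom ≫ F.nPar B A = F.nPar A B ≫ (pBraid _ _).hom
  νt_braid (A B : X) :
    F.νtR A B ≫ (pBraid _ _).hom = F.Ft.map (pBraid A B).hom ≫ F.νtL B A
  νp_braid (A B : X) :
    F.νpR A B ≫ F.Fp.map (tBraid A B).hom = (tBraid _ _).hom ≫ F.νpL B A

/-! ### Medial linear functors -/

namespace MedialFunctorData

section

variable [LDC X] [LDC Y] (F : MedialFunctorData X Y)

/-- `m_⊥`. -/
abbrev mBot : bot Y ⟶ F.Ft.obj (bot X) := F.pLax.ε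

/-- `m_⊕`. -/
abbrev mPar (A B : X) : F.Ft.obj A ⊕ₒ F.Ft.obj B ⟶ F.Ft.obj (A ⊕ₒ B) := F.pLax.μ A B

/-- `n_⊤`. -/
abbrev nTop : F.Fp.obj (top X) ⟶ top Y := F.tOplax.η

/-- `n_⊗`. -/
abbrev nTen (A B : X) : F.Fp.obj (A ⊗ₒ B) ⟶ F.Fp.obj A ⊗ₒ F.Fp.obj B := F.tOplax.δ A B

end

/-- The data form a strong symmetric medial linear functor. -/
structure IsMedial [SymmetricMLDC X] [SymmetricMLDC Y] (F : MedialFunctorData X Y) : Prop where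
  -- `F` is a symmetric linear functor
  isLinear : F.toLinearFunctorData.IsLinear
  isSymmetric : F.toLinearFunctorData.IsSymmetric
  -- strength
  mTop_iso : IsIso F.mTop
  mTen_iso : ∀ A B : X, IsIso (F.mTen A B)
  nBot_iso : IsIso F.nBot
  nPar_iso : ∀ A B : X, IsIso (F.nPar A B)
  -- the additional (co)monoidal structures are symmetric
  mPar_braid (A B : X) :
    F.mPar A B ≫ F.Ft.map (pBraid A B).hom = (pBraid _ _).hom ≫ F.mPar B A
  nTen_braid (A B : X) :
    F.Fp.map (tBraid A B).hom ≫ F.nTen B A = F.nTen A B ≫ (tBraid _ _).hom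
  -- `F_⊗` with `m_⊥, m_⊕` and the inverses of `m_⊤, m_⊗` is a bilax duoidal functor
  mBot_Δbot : Δbot ≫ (F.mBot ⊗ₕ F.mBot) ≫ F.mTen (bot X) (bot X) = F.mBot ≫ F.Ft.map Δbot
  mTop_nablaTop :
    (F.mTop ⊕ₕ F.mTop) ≫ F.mPar (top X) (top X) ≫ F.Ft.map nablaTop = nablaTop ≫ F.mTop
  mix_mTop : mix ≫ F.mTop = F.mBot ≫ F.Ft.map mix
  mTen_μ (A B C D : X) :
    (F.mTen A B ⊕ₕ F.mTen C D) ≫ F.mPar (A ⊗ₒ B) (C ⊗ₒ D) ≫ F.Ft.map (μ A B C D) =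
      μ _ _ _ _ ≫ (F.mPar A C ⊗ₕ F.mPar B D) ≫ F.mTen (A ⊕ₒ C) (B ⊕ₒ D)
  -- `F_⊕` with `n_⊤, n_⊗` and the inverses of `n_⊥, n_⊕` is a bilax duoidal functor
  nBot_Δbot : F.Fp.map Δbot ≫ F.nTen (bot X) (bot X) ≫ (F.nBot ⊗ₕ F.nBot) = F.nBot ≫ Δbot
  nTop_nablaTop :
    F.nPar (top X) (top X) ≫ (F.nTop ⊕ₕ F.nTop) ≫ nablaTop = F.Fp.map nablaTop ≫ F.nTop
  nBot_mix : F.nBot ≫ mix = F.Fp.map mix ≫ F.nTop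
  nPar_μ (A B C D : X) :
    F.Fp.map (μ A B C D) ≫ F.nTen (A ⊕ₒ C) (B ⊕ₒ D) ≫ (F.nPar A C ⊗ₕ F.nPar B D) =
      F.nPar (A ⊗ₒ B) (C ⊗ₒ D) ≫ (F.nTen A B ⊕ₕ F.nTen C D) ≫ μ _ _ _ _
  -- linear strengths, `⊥`-contraction and `⊤`-cocontraction
  νpR_Δbot :
    F.Fp.map Δbot = F.nBot ≫ Δbot ≫ (F.mBot ⊗ₕ inv F.nBot) ≫ F.νpR (bot X) (bot X)
  νtR_nablaTop :
    F.Ft.map nablaTop = F.νtR (top X) (top X) ≫ (F.nTop ⊕ₕ inv F.mTop) ≫ nablaTop ≫ F.mTop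
  -- linear strengths and medial maps
  νtR_μ (A B C D : X) :
    F.Ft.map (μ A B C D) ≫ inv (F.mTen (A ⊕ₒ C) (B ⊕ₒ D)) ≫ (F.νtR A C ⊗ₕ F.νtR B D) =
      F.νtR (A ⊗ₒ B) (C ⊗ₒ D) ≫ (F.nTen A B ⊕ₕ inv (F.mTen C D)) ≫ μ _ _ _ _
  νpR_μ (A B C D : X) :
    (F.νpR A B ⊕ₕ F.νpR C D) ≫ inv (F.nPar (A ⊗ₒ B) (C ⊗ₒ D)) ≫ F.Fp.map (μ A B C D) =
      μ _ _ _ _ ≫ (F.mPar A C ⊗ₕ inv (F.nPar B D)) ≫ F.νpR (A ⊕ₒ C) (B ⊕ₒ D)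
  -- linear strengths, `m_⊕` and `n_⊗`
  νtR_mPar (A B C : X) :
    F.mPar (A ⊕ₒ B) C ≫ F.Ft.map (pAssoc A B C).inv ≫ F.νtR A (B ⊕ₒ C) =
      (F.νtR A B ⊕ₕ 𝟙 (F.Ft.obj C)) ≫ (pAssoc _ _ _).inv ≫ (𝟙 (F.Fp.obj A) ⊕ₕ F.mPar B C)
  νpR_nTen (A B C : X) :
    F.νpR A (B ⊗ₒ C) ≫ F.Fp.map (tAssoc A B C).inv ≫ F.nTen (A ⊗ₒ B) C =
      (𝟙 (F.Ft.obj A) ⊗ₕ F.nTen B C) ≫ (tAssoc _ _ _).inv ≫ (F.νpR A B ⊗ₕ 𝟙 (F.Fp.obj C))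

variable (X) in
/-- The identity functor, with identity structure maps. -/
def id [LDC X] : MedialFunctorData X X where
  Ft := 𝟭 X
  Fp := 𝟭 X
  tLax := @Functor.LaxMonoidal.id X _ TwoMonoidal.ten
  pOplax := @Functor.OplaxMonoidal.id X _ TwoMonoidal.par
  pLax := @Functor.LaxMonoidal.id X _ TwoMonoidal.par
  tOplax := @Functor.OplaxMonoidal.id X _ TwoMonoidal.ten
  νtR A B := 𝟙 (A ⊕ₒ B)
  νtL A B := 𝟙 (A ⊕ₒ B)
  νpR A B := 𝟙 (A ⊗ₒ B)
  νpL A B := 𝟙 (A ⊗ₒ B)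

/-- The composite `F ; G = (F_⊗ ; G_⊗, F_⊕ ; G_⊕)`, with the composite (co)monoidal structures and
linear strengths. -/
def comp {Z : Type u} [Category.{v} Z] [LDC X] [LDC Y] [LDC Z]
    (F : MedialFunctorData X Y) (G : MedialFunctorData Y Z) : MedialFunctorData X Z where
  Ft := F.Ft ⋙ G.Ft
  Fp := F.Fp ⋙ G.Fp
  tLax := @Functor.LaxMonoidal.comp _ _ TwoMonoidal.ten _ _ TwoMonoidal.ten _ _ TwoMonoidal.ten
    F.Ft G.Ft F.tLax G.tLax
  pOplax := @Functor.OplaxMonoidal.comp _ _ TwoMonoidal.par _ _ TwoMonoidal.par _ _ TwoMonoidal.par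
    F.Fp G.Fp F.pOplax G.pOplax
  pLax := @Functor.LaxMonoidal.comp _ _ TwoMonoidal.par _ _ TwoMonoidal.par _ _ TwoMonoidal.par
    F.Ft G.Ft F.pLax G.pLax
  tOplax := @Functor.OplaxMonoidal.comp _ _ TwoMonoidal.ten _ _ TwoMonoidal.ten _ _ TwoMonoidal.ten
    F.Fp G.Fp F.tOplax G.tOplax
  νtR A B := G.Ft.map (F.νtR A B) ≫ G.νtR (F.Fp.obj A) (F.Ft.obj B)
  νtL A B := G.Ft.map (F.νtL A B) ≫ G.νtL (F.Ft.obj A) (F.Fp.obj B)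
  νpR A B := G.νpR (F.Ft.obj A) (F.Fp.obj B) ≫ G.Fp.map (F.νpR A B)
  νpL A B := G.νpL (F.Fp.obj A) (F.Ft.obj B) ≫ G.Fp.map (F.νpL A B)

section Strictness

variable {Z : Type u} [Category.{v} Z] {W : Type u} [Category.{v} W]
  [LDC X] [LDC Y] [LDC Z] [LDC W]

theorem id_comp (F : MedialFunctorData X Y) : (id X).comp F = F := by
  have l (H : X ⥤ Y) {A : X} {B : Y} (f : B ⟶ H.obj A) : f ≫ H.map (𝟙 A) = f := by simp
  have o (H : X ⥤ Y) {A : X} {B : Y} (f : H.obj A ⟶ B) : H.map (𝟙 A) ≫ f = f := by simp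
  obtain ⟨⟨Ft, Fp, _, _, _, _, _, _⟩, _, _⟩ := F
  simp only [comp, id, mk.injEq, LinearFunctorData.mk.injEq]
  exact ⟨⟨rfl, rfl,
    heq_of_eq (Functor.LaxMonoidal.ext (l Ft _) (funext₂ fun _ _ => l Ft _)),
    heq_of_eq (Functor.OplaxMonoidal.ext (o Fp _) (funext₂ fun _ _ => o Fp _)),
    heq_of_eq (funext₂ fun _ _ => o Ft _), heq_of_eq (funext₂ fun _ _ => o Ft _),
    heq_of_eq (funext₂ fun _ _ => l Fp _), heq_of_eq (funext₂ fun _ _ => l Fp _)⟩,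
    heq_of_eq (Functor.LaxMonoidal.ext (l Ft _) (funext₂ fun _ _ => l Ft _)),
    heq_of_eq (Functor.OplaxMonoidal.ext (o Fp _) (funext₂ fun _ _ => o Fp _))⟩

theorem comp_id (F : MedialFunctorData X Y) : F.comp (id Y) = F := by
  have l {A B : Y} (f : A ⟶ B) : 𝟙 A ≫ f = f := Category.id_comp f
  have o {A B : Y} (f : A ⟶ B) : f ≫ 𝟙 B = f := Category.comp_id f
  obtain ⟨⟨Ft, Fp, _, _, _, _, _, _⟩, _, _⟩ := F
  simp only [comp, id, mk.injEq, LinearFunctorData.mk.injEq]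
  exact ⟨⟨rfl, rfl,
    heq_of_eq (Functor.LaxMonoidal.ext (l _) (funext₂ fun _ _ => l _)),
    heq_of_eq (Functor.OplaxMonoidal.ext (o _) (funext₂ fun _ _ => o _)),
    heq_of_eq (funext₂ fun _ _ => o _), heq_of_eq (funext₂ fun _ _ => o _),
    heq_of_eq (funext₂ fun _ _ => l _), heq_of_eq (funext₂ fun _ _ => l _)⟩,
    heq_of_eq (Functor.LaxMonoidal.ext (l _) (funext₂ fun _ _ => l _)),
    heq_of_eq (Functor.OplaxMonoidal.ext (o _) (funext₂ fun _ _ => o _))⟩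

theorem assoc (F : MedialFunctorData X Y) (G : MedialFunctorData Y Z) (H : MedialFunctorData Z W) :
    (F.comp G).comp H = F.comp (G.comp H) := by
  have l (K : Z ⥤ W) {A : W} {B C D : Z} (f : A ⟶ K.obj B) (g : B ⟶ C) (k : C ⟶ D) :
      f ≫ K.map (g ≫ k) = (f ≫ K.map g) ≫ K.map k := by simp
  have o (K : Z ⥤ W) {A : W} {B C D : Z} (f : K.obj B ⟶ A) (g : C ⟶ B) (k : D ⟶ C) :
      K.map (k ≫ g) ≫ f = K.map k ≫ K.map g ≫ f := by simp
  simp only [comp, mk.injEq, LinearFunctorData.mk.injEq]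
  exact ⟨⟨rfl, rfl,
    heq_of_eq (Functor.LaxMonoidal.ext (l H.Ft _ _ _) (funext₂ fun _ _ => l H.Ft _ _ _)),
    heq_of_eq (Functor.OplaxMonoidal.ext (o H.Fp _ _ _) (funext₂ fun _ _ => o H.Fp _ _ _)),
    heq_of_eq (funext₂ fun _ _ => o H.Ft _ _ _), heq_of_eq (funext₂ fun _ _ => o H.Ft _ _ _),
    heq_of_eq (funext₂ fun _ _ => l H.Fp _ _ _), heq_of_eq (funext₂ fun _ _ => l H.Fp _ _ _)⟩,
    heq_of_eq (Functor.LaxMonoidal.ext (l H.Ft _ _ _) (funext₂ fun _ _ => l H.Ft _ _ _)),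
    heq_of_eq (Functor.OplaxMonoidal.ext (o H.Fp _ _ _) (funext₂ fun _ _ => o H.Fp _ _ _))⟩

end Strictness

end MedialFunctorData

end Functors

/-! ### Medial linear transformations -/

section Transformations

variable {X : Type u} [Category.{v} X] {Y : Type u} [Category.{v} Y]
  {Z : Type u} [Category.{v} Z]

/-- A pair of natural transformations `α_⊗ : F_⊗ ⟶ G_⊗` and `α_⊕ : G_⊕ ⟶ F_⊕`. -/
@[ext]
structure TransData [LDC X] [LDC Y] (F G : MedialFunctorData X Y) where
  /-- `α_⊗` -/
  t : F.Ft ⟶ G.Ft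
  /-- `α_⊕` -/
  p : G.Fp ⟶ F.Fp

namespace TransData

variable [LDC X] [LDC Y] [LDC Z]

/-- The pair is a strong medial linear transformation. -/
structure IsMedial {F G : MedialFunctorData X Y} (α : TransData F G) : Prop where
  -- `α_⊗` is a monoidal transformation for the tensors
  t_mTop : F.mTop ≫ α.t.app (top X) = G.mTop
  t_mTen (A B : X) : F.mTen A B ≫ α.t.app (A ⊗ₒ B) = (α.t.app A ⊗ₕ α.t.app B) ≫ G.mTen A B
  -- `α_⊗` is a monoidal transformation for the pars
  t_mBot : F.mBot ≫ α.t.app (bot X) = G.mBot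
  t_mPar (A B : X) : F.mPar A B ≫ α.t.app (A ⊕ₒ B) = (α.t.app A ⊕ₕ α.t.app B) ≫ G.mPar A B
  -- `α_⊕` is a comonoidal transformation for the pars
  p_nBot : α.p.app (bot X) ≫ F.nBot = G.nBot
  p_nPar (A B : X) : α.p.app (A ⊕ₒ B) ≫ F.nPar A B = G.nPar A B ≫ (α.p.app A ⊕ₕ α.p.app B)
  -- `α_⊕` is a comonoidal transformation for the tensors
  p_nTop : α.p.app (top X) ≫ F.nTop = G.nTop
  p_nTen (A B : X) : α.p.app (A ⊗ₒ B) ≫ F.nTen A B = G.nTen A B ≫ (α.p.app A ⊗ₕ α.p.app B)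
  -- compatibility with the linear strengths
  νtR (A B : X) :
    α.t.app (A ⊕ₒ B) ≫ G.νtR A B ≫ (α.p.app A ⊕ₕ 𝟙 (G.Ft.obj B)) =
      F.νtR A B ≫ (𝟙 (F.Fp.obj A) ⊕ₕ α.t.app B)
  νtL (A B : X) :
    α.t.app (A ⊕ₒ B) ≫ G.νtL A B ≫ (𝟙 (G.Ft.obj A) ⊕ₕ α.p.app B) =
      F.νtL A B ≫ (α.t.app A ⊕ₕ 𝟙 (F.Fp.obj B))
  νpL (A B : X) :
    (𝟙 (G.Fp.obj A) ⊗ₕ α.t.app B) ≫ G.νpL A B ≫ α.p.app (A ⊗ₒ B) =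
      (α.p.app A ⊗ₕ 𝟙 (F.Ft.obj B)) ≫ F.νpL A B
  νpR (A B : X) :
    (α.t.app A ⊗ₕ 𝟙 (G.Fp.obj B)) ≫ G.νpR A B ≫ α.p.app (A ⊗ₒ B) =
      (𝟙 (F.Ft.obj A) ⊗ₕ α.p.app B) ≫ F.νpR A B

/-- The identity transformation. -/
def id (F : MedialFunctorData X Y) : TransData F F := ⟨𝟙 F.Ft, 𝟙 F.Fp⟩

/-- Vertical composition. -/
def comp {F G H : MedialFunctorData X Y} (α : TransData F G) (β : TransData G H) :
    TransData F H := ⟨α.t ≫ β.t, β.p ≫ α.p⟩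

/-- Horizontal composition. -/
def hcomp {F F' : MedialFunctorData X Y} {G G' : MedialFunctorData Y Z}
    (α : TransData F F') (β : TransData G G') : TransData (F.comp G) (F'.comp G') :=
  ⟨NatTrans.hcomp α.t β.t, NatTrans.hcomp α.p β.p⟩

/-- Left whiskering, i.e. horizontal composition with the identity of `F`. -/
def whiskerLeft (F : MedialFunctorData X Y) {G G' : MedialFunctorData Y Z} (β : TransData G G') :
    TransData (F.comp G) (F.comp G') :=
  ⟨Functor.whiskerLeft F.Ft β.t, Functor.whiskerLeft F.Fp β.p⟩

/-- Right whiskering, i.e. horizontal composition with the identity of `G`. -/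
def whiskerRight {F F' : MedialFunctorData X Y} (α : TransData F F') (G : MedialFunctorData Y Z) :
    TransData (F.comp G) (F'.comp G) :=
  ⟨Functor.whiskerRight α.t G.Ft, Functor.whiskerRight α.p G.Fp⟩

end TransData

end Transformations

/-! ### The 2-category -/

/-- The type of symmetric medial linearly distributive categories: the 0-cells. -/
structure SMLDC where
  /-- the underlying type of objects -/
  carrier : Type u
  [cat : Category.{v} carrier]
  [str : SymmetricMLDC carrier]

attribute [instance] SMLDC.cat SMLDC.str

/-- Strong symmetric medial linear functors: the 1-cells. -/
@[ext]
structure MedialLinearFunctor (X Y : SMLDC.{v, u}) where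
  /-- the functors and structure maps -/
  data : MedialFunctorData X.carrier Y.carrier
  isMedial : data.IsMedial

/-- Strong medial linear transformations: the 2-cells. -/
@[ext]
structure MedialLinearTransformation {X Y : SMLDC.{v, u}} (F G : MedialLinearFunctor X Y) where
  /-- the pair of natural transformations -/
  data : TransData F.data G.data
  isMedial : data.IsMedial

/-- Identities and composites of medial linear functors and of medial linear transformations are
again medial linear functors and medial linear transformations. -/
structure SMLDC.IsClosed : Prop where
  id_functor (X : SMLDC.{v, u}) : (MedialFunctorData.id X.carrier).IsMedial
  comp_functor {X Y Z : SMLDC.{v, u}} (F : MedialLinearFunctor X Y) (G : MedialLinearFunctor Y Z) :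
    (F.data.comp G.data).IsMedial
  id_trans {X Y : SMLDC.{v, u}} (F : MedialLinearFunctor X Y) : (TransData.id F.data).IsMedial
  comp_trans {X Y : SMLDC.{v, u}} {F G H : MedialLinearFunctor X Y}
    (α : MedialLinearTransformation F G) (β : MedialLinearTransformation G H) :
    (α.data.comp β.data).IsMedial
  hcomp_trans {X Y Z : SMLDC.{v, u}} {F F' : MedialLinearFunctor X Y}
    {G G' : MedialLinearFunctor Y Z} (α : MedialLinearTransformation F F')
    (β : MedialLinearTransformation G G') : (α.data.hcomp β.data).IsMedial
  whiskerLeft_trans {X Y Z : SMLDC.{v, u}} (F : MedialLinearFunctor X Y)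
    {G G' : MedialLinearFunctor Y Z} (β : MedialLinearTransformation G G') :
    (TransData.whiskerLeft F.data β.data).IsMedial
  whiskerRight_trans {X Y Z : SMLDC.{v, u}} {F F' : MedialLinearFunctor X Y}
    (α : MedialLinearTransformation F F') (G : MedialLinearFunctor Y Z) :
    (TransData.whiskerRight α.data G.data).IsMedial

namespace SMLDC

/-- The 1-cells with their identities and composition. -/
abbrev oneCells (h : IsClosed.{v, u}) : CategoryStruct SMLDC.{v, u} where
  Hom X Y := MedialLinearFunctor X Y
  id X := ⟨MedialFunctorData.id X.carrier, h.id_functor X⟩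
  comp F G := ⟨F.data.comp G.data, h.comp_functor F G⟩

/-- The category of 1-cells `X ⟶ Y` and 2-cells, with vertical composition. -/
abbrev homCategory (h : IsClosed.{v, u}) (X Y : SMLDC.{v, u}) :
    Category (MedialLinearFunctor X Y) where
  Hom F G := MedialLinearTransformation F G
  id F := ⟨TransData.id F.data, h.id_trans F⟩
  comp α β := ⟨α.data.comp β.data, h.comp_trans α β⟩
  id_comp α := by
    ext <;> simp [TransData.id, TransData.comp]
  comp_id α := by
    ext <;> simp [TransData.id, TransData.comp]
  assoc α β γ := by
    ext <;> simp [TransData.comp]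

/-- The pair of identities is a medial linear transformation `F ⟶ F'` when `F = F'`. -/
theorem isMedial_of_eq {X Y : Type u} [Category.{v} X] [LDC X] [Category.{v} Y] [LDC Y]
    {F F' : MedialFunctorData X Y} (e : F = F') (α : TransData F F')
    (ht : α.t = eqToHom (by rw [e])) (hp : α.p = eqToHom (by rw [e])) : α.IsMedial := by
  subst e
  constructor <;> intros <;> simp [ht, hp]

theorem twoCell_ext {X Y : SMLDC.{v, u}} {F G : MedialLinearFunctor X Y}
    {α β : MedialLinearTransformation F G}
    (ht : ∀ A, α.data.t.app A = β.data.t.app A) (hp : ∀ A, α.data.p.app A = β.data.p.app A) :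
    α = β :=
  MedialLinearTransformation.ext
    (TransData.ext (NatTrans.ext (funext ht)) (NatTrans.ext (funext hp)))

/-- SMLDCs, medial linear functors and medial linear transformations, with the identities and
compositions of `IsClosed`; the unitors and associators have identity components. -/
abbrev bicategory (h : IsClosed.{v, u}) : Bicategory.{max u v, max u v} SMLDC.{v, u} :=
  letI := oneCells h
  letI := fun X Y => homCategory h X Y
  { oneCells h with
    homCategory := homCategory h
    whiskerLeft := fun F _ _ β => ⟨TransData.whiskerLeft F.data β.data, h.whiskerLeft_trans F β⟩
    whiskerRight := fun α G => ⟨TransData.whiskerRight α.data G.data, h.whiskerRight_trans α G⟩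
    leftUnitor := fun F => @Iso.mk _ (homCategory h _ _) _ _
      ⟨⟨𝟙 F.data.Ft, 𝟙 F.data.Fp⟩, isMedial_of_eq F.data.id_comp _ rfl rfl⟩
      ⟨⟨𝟙 F.data.Ft, 𝟙 F.data.Fp⟩, isMedial_of_eq F.data.id_comp.symm _ rfl rfl⟩
      (twoCell_ext (fun _ => Category.comp_id _) (fun _ => Category.comp_id _))
      (twoCell_ext (fun _ => Category.comp_id _) (fun _ => Category.comp_id _))
    rightUnitor := fun F => @Iso.mk _ (homCategory h _ _) _ _
      ⟨⟨𝟙 F.data.Ft, 𝟙 F.data.Fp⟩, isMedial_of_eq F.data.comp_id _ rfl rfl⟩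
      ⟨⟨𝟙 F.data.Ft, 𝟙 F.data.Fp⟩, isMedial_of_eq F.data.comp_id.symm _ rfl rfl⟩
      (twoCell_ext (fun _ => Category.comp_id _) (fun _ => Category.comp_id _))
      (twoCell_ext (fun _ => Category.comp_id _) (fun _ => Category.comp_id _))
    associator := fun F G H => @Iso.mk _ (homCategory h _ _) _ _
      ⟨⟨𝟙 (F.data.Ft ⋙ G.data.Ft ⋙ H.data.Ft), 𝟙 (F.data.Fp ⋙ G.data.Fp ⋙ H.data.Fp)⟩,
        isMedial_of_eq (F.data.assoc G.data H.data) _ rfl rfl⟩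
      ⟨⟨𝟙 (F.data.Ft ⋙ G.data.Ft ⋙ H.data.Ft), 𝟙 (F.data.Fp ⋙ G.data.Fp ⋙ H.data.Fp)⟩,
        isMedial_of_eq (F.data.assoc G.data H.data).symm _ rfl rfl⟩
      (twoCell_ext (fun _ => Category.comp_id _) (fun _ => Category.comp_id _))
      (twoCell_ext (fun _ => Category.comp_id _) (fun _ => Category.comp_id _))
    whiskerLeft_id := fun _ _ => twoCell_ext (fun _ => rfl) (fun _ => rfl)
    whiskerLeft_comp := fun _ _ _ _ _ _ => twoCell_ext (fun _ => rfl) (fun _ => rfl)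
    id_whiskerLeft := fun η => twoCell_ext
      (fun A => ((Category.id_comp _).trans (Category.comp_id (η.data.t.app A))).symm)
      (fun A => ((Category.assoc _ _ _).trans
        ((Category.id_comp _).trans (Category.comp_id (η.data.p.app A)))).symm)
    comp_whiskerLeft := fun _ _ _ _ η => twoCell_ext
      (fun _ => ((Category.id_comp _).trans (Category.comp_id (η.data.t.app _))).symm)
      (fun _ => ((Category.assoc _ _ _).trans
        ((Category.id_comp _).trans (Category.comp_id (η.data.p.app _)))).symm)
    id_whiskerRight := fun _ G => twoCell_ext (fun _ => G.data.Ft.map_id _)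
      (fun _ => G.data.Fp.map_id _)
    comp_whiskerRight := fun _ _ G => twoCell_ext (fun _ => G.data.Ft.map_comp _ _)
      (fun _ => G.data.Fp.map_comp _ _)
    whiskerRight_id := fun η => twoCell_ext
      (fun A => ((Category.id_comp _).trans (Category.comp_id (η.data.t.app A))).symm)
      (fun A => ((Category.assoc _ _ _).trans
        ((Category.id_comp _).trans (Category.comp_id (η.data.p.app A)))).symm)
    whiskerRight_comp := fun _ _ _ => twoCell_ext
      (fun _ => ((Category.id_comp _).trans (Category.comp_id _)).symm)
      (fun _ => ((Category.assoc _ _ _).trans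
        ((Category.id_comp _).trans (Category.comp_id _))).symm)
    whisker_assoc := fun _ _ _ _ _ => twoCell_ext
      (fun _ => ((Category.id_comp _).trans (Category.comp_id _)).symm)
      (fun _ => ((Category.assoc _ _ _).trans
        ((Category.id_comp _).trans (Category.comp_id _))).symm)
    whisker_exchange := fun η θ => twoCell_ext
      (fun A => (θ.data.t.naturality (η.data.t.app A)).symm)
      (fun A => θ.data.p.naturality (η.data.p.app A))
    pentagon := fun _ _ _ K => twoCell_ext
      (fun _ => (congrArg (· ≫ 𝟙 _ ≫ 𝟙 _) (K.data.Ft.map_id _)).trans (Category.id_comp _))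
      (fun _ => (congrArg ((𝟙 _ ≫ 𝟙 _) ≫ ·) (K.data.Fp.map_id _)).trans (Category.comp_id _))
    triangle := fun _ G => twoCell_ext
      (fun _ => (Category.id_comp _).trans (G.data.Ft.map_id _).symm)
      (fun _ => (Category.id_comp _).trans (G.data.Fp.map_id _).symm) }

end SMLDC

end MedialLD

/-!
Every axiom of a composite functor has the same proof. Its structure maps are those of `G`
composed with the `G`-images of those of `F`, so naturality of the structure maps of `G` moves the
images together, the axiom of `F` under `G` rewrites them, and the axiom of `G` does the rest.
Axioms of a whiskered transformation are likewise the image of an axiom, or an instance of one, up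
to naturality, and horizontal composites are vertical composites of whiskerings. The composition
of 1-cells is strictly unital and associative, and the unitors and associators have identity
components, so they are the 2-cells induced by these equalities.
-/

namespace MedialLD

open LDC MLDC

section TwoMonoidal

variable {X : Type u} [Category.{v} X] [TwoMonoidal X]

theorem id_tHom_id (A B : X) : 𝟙 A ⊗ₕ 𝟙 B = 𝟙 (A ⊗ₒ B) :=
  (TwoMonoidal.ten (X := X)).id_tensorHom_id A B

theorem id_pHom_id (A B : X) : 𝟙 A ⊕ₕ 𝟙 B = 𝟙 (A ⊕ₒ B) :=
  (TwoMonoidal.par (X := X)).id_tensorHom_id A B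

theorem tHom_comp_tHom {A A' A'' B B' B'' : X} (f : A ⟶ A') (f' : A' ⟶ A'') (g : B ⟶ B')
    (g' : B' ⟶ B'') : (f ⊗ₕ g) ≫ (f' ⊗ₕ g') = (f ≫ f') ⊗ₕ (g ≫ g') :=
  (TwoMonoidal.ten (X := X)).tensorHom_comp_tensorHom f g f' g'

theorem pHom_comp_pHom {A A' A'' B B' B'' : X} (f : A ⟶ A') (f' : A' ⟶ A'') (g : B ⟶ B')
    (g' : B' ⟶ B'') : (f ⊕ₕ g) ≫ (f' ⊕ₕ g') = (f ≫ f') ⊕ₕ (g ≫ g') :=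
  (TwoMonoidal.par (X := X)).tensorHom_comp_tensorHom f g f' g'

theorem comp_tHom_id {A B C : X} (f : A ⟶ B) (g : B ⟶ C) (D : X) :
    (f ≫ g) ⊗ₕ 𝟙 D = (f ⊗ₕ 𝟙 D) ≫ (g ⊗ₕ 𝟙 D) := by
  rw [tHom_comp_tHom, Category.comp_id]

theorem id_tHom_comp {A B C : X} (D : X) (f : A ⟶ B) (g : B ⟶ C) :
    𝟙 D ⊗ₕ (f ≫ g) = (𝟙 D ⊗ₕ f) ≫ (𝟙 D ⊗ₕ g) := by
  rw [tHom_comp_tHom, Category.comp_id]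

theorem comp_pHom_id {A B C : X} (f : A ⟶ B) (g : B ⟶ C) (D : X) :
    (f ≫ g) ⊕ₕ 𝟙 D = (f ⊕ₕ 𝟙 D) ≫ (g ⊕ₕ 𝟙 D) := by
  rw [pHom_comp_pHom, Category.comp_id]

theorem id_pHom_comp {A B C : X} (D : X) (f : A ⟶ B) (g : B ⟶ C) :
    𝟙 D ⊕ₕ (f ≫ g) = (𝟙 D ⊕ₕ f) ≫ (𝟙 D ⊕ₕ g) := by
  rw [pHom_comp_pHom, Category.comp_id]

theorem tHom_exchange {A A' B B' : X} (f : A ⟶ A') (g : B ⟶ B') :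
    (𝟙 A ⊗ₕ g) ≫ (f ⊗ₕ 𝟙 B') = (f ⊗ₕ 𝟙 B) ≫ (𝟙 A' ⊗ₕ g) := by
  simp only [tHom_comp_tHom, Category.id_comp, Category.comp_id]

theorem pHom_exchange {A A' B B' : X} (f : A ⟶ A') (g : B ⟶ B') :
    (𝟙 A ⊕ₕ g) ≫ (f ⊕ₕ 𝟙 B') = (f ⊕ₕ 𝟙 B) ≫ (𝟙 A' ⊕ₕ g) := by
  simp only [pHom_comp_pHom, Category.id_comp, Category.comp_id]

end TwoMonoidal

/-! ### Composition of linear functors -/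

namespace LinearFunctorData

section Naturality

variable {X : Type u} [Category.{v} X] {Y : Type u} [Category.{v} Y] [LDC X] [LDC Y]
  (F : LinearFunctorData X Y)

theorem mTen_natural {A A' B B' : X} (f : A ⟶ A') (g : B ⟶ B') :
    (F.Ft.map f ⊗ₕ F.Ft.map g) ≫ F.mTen A' B' = F.mTen A B ≫ F.Ft.map (f ⊗ₕ g) :=
  @Functor.LaxMonoidal.μ_natural _ _ TwoMonoidal.ten _ _ TwoMonoidal.ten F.Ft F.tLax _ _ _ _ f g

theorem nPar_natural {A A' B B' : X} (f : A ⟶ A') (g : B ⟶ B') :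
    F.Fp.map (f ⊕ₕ g) ≫ F.nPar A' B' = F.nPar A B ≫ (F.Fp.map f ⊕ₕ F.Fp.map g) :=
  (@Functor.OplaxMonoidal.δ_natural _ _ TwoMonoidal.par _ _ TwoMonoidal.par F.Fp F.pOplax
    _ _ _ _ f g).symm

theorem mTen_natural_left {A A' : X} (f : A ⟶ A') (B : X) :
    (F.Ft.map f ⊗ₕ 𝟙 (F.Ft.obj B)) ≫ F.mTen A' B = F.mTen A B ≫ F.Ft.map (f ⊗ₕ 𝟙 B) := by
  rw [← F.mTen_natural, CategoryTheory.Functor.map_id]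

theorem mTen_natural_right (A : X) {B B' : X} (g : B ⟶ B') :
    (𝟙 (F.Ft.obj A) ⊗ₕ F.Ft.map g) ≫ F.mTen A B' = F.mTen A B ≫ F.Ft.map (𝟙 A ⊗ₕ g) := by
  rw [← F.mTen_natural, CategoryTheory.Functor.map_id]

theorem nPar_natural_left {A A' : X} (f : A ⟶ A') (B : X) :
    F.Fp.map (f ⊕ₕ 𝟙 B) ≫ F.nPar A' B = F.nPar A B ≫ (F.Fp.map f ⊕ₕ 𝟙 (F.Fp.obj B)) := by
  rw [F.nPar_natural, CategoryTheory.Functor.map_id]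

theorem nPar_natural_right (A : X) {B B' : X} (g : B ⟶ B') :
    F.Fp.map (𝟙 A ⊕ₕ g) ≫ F.nPar A B' = F.nPar A B ≫ (𝟙 (F.Fp.obj A) ⊕ₕ F.Fp.map g) := by
  rw [F.nPar_natural, CategoryTheory.Functor.map_id]

theorem inv_mTen_natural {A A' B B' : X} (f : A ⟶ A') (g : B ⟶ B') [IsIso (F.mTen A B)]
    [IsIso (F.mTen A' B')] :
    inv (F.mTen A B) ≫ (F.Ft.map f ⊗ₕ F.Ft.map g) = F.Ft.map (f ⊗ₕ g) ≫ inv (F.mTen A' B') := by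
  rw [IsIso.inv_comp_eq, ← Category.assoc, IsIso.eq_comp_inv, F.mTen_natural]

theorem inv_nPar_natural {A A' B B' : X} (f : A ⟶ A') (g : B ⟶ B') [IsIso (F.nPar A B)]
    [IsIso (F.nPar A' B')] :
    (F.Fp.map f ⊕ₕ F.Fp.map g) ≫ inv (F.nPar A' B') = inv (F.nPar A B) ≫ F.Fp.map (f ⊕ₕ g) := by
  rw [IsIso.eq_inv_comp, ← Category.assoc, IsIso.comp_inv_eq, F.nPar_natural]

variable {F}

namespace IsLinear

theorem νtR_natural_left (hF : F.IsLinear) {A A' : X} (f : A ⟶ A') (B : X) :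
    F.Ft.map (f ⊕ₕ 𝟙 B) ≫ F.νtR A' B = F.νtR A B ≫ (F.Fp.map f ⊕ₕ 𝟙 (F.Ft.obj B)) := by
  rw [hF.νtR_natural, CategoryTheory.Functor.map_id]

theorem νtR_natural_right (hF : F.IsLinear) (A : X) {B B' : X} (g : B ⟶ B') :
    F.Ft.map (𝟙 A ⊕ₕ g) ≫ F.νtR A B' = F.νtR A B ≫ (𝟙 (F.Fp.obj A) ⊕ₕ F.Ft.map g) := by
  rw [hF.νtR_natural, CategoryTheory.Functor.map_id]

theorem νtL_natural_left (hF : F.IsLinear) {A A' : X} (f : A ⟶ A') (B : X) :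
    F.Ft.map (f ⊕ₕ 𝟙 B) ≫ F.νtL A' B = F.νtL A B ≫ (F.Ft.map f ⊕ₕ 𝟙 (F.Fp.obj B)) := by
  rw [hF.νtL_natural, CategoryTheory.Functor.map_id]

theorem νtL_natural_right (hF : F.IsLinear) (A : X) {B B' : X} (g : B ⟶ B') :
    F.Ft.map (𝟙 A ⊕ₕ g) ≫ F.νtL A B' = F.νtL A B ≫ (𝟙 (F.Ft.obj A) ⊕ₕ F.Fp.map g) := by
  rw [hF.νtL_natural, CategoryTheory.Functor.map_id]

theorem νpR_natural_left (hF : F.IsLinear) {A A' : X} (f : A ⟶ A') (B : X) :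
    (F.Ft.map f ⊗ₕ 𝟙 (F.Fp.obj B)) ≫ F.νpR A' B = F.νpR A B ≫ F.Fp.map (f ⊗ₕ 𝟙 B) := by
  rw [← hF.νpR_natural, CategoryTheory.Functor.map_id]

theorem νpR_natural_right (hF : F.IsLinear) (A : X) {B B' : X} (g : B ⟶ B') :
    (𝟙 (F.Ft.obj A) ⊗ₕ F.Fp.map g) ≫ F.νpR A B' = F.νpR A B ≫ F.Fp.map (𝟙 A ⊗ₕ g) := by
  rw [← hF.νpR_natural, CategoryTheory.Functor.map_id]

theorem νpL_natural_left (hF : F.IsLinear) {A A' : X} (f : A ⟶ A') (B : X) :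
    (F.Fp.map f ⊗ₕ 𝟙 (F.Ft.obj B)) ≫ F.νpL A' B = F.νpL A B ≫ F.Fp.map (f ⊗ₕ 𝟙 B) := by
  rw [← hF.νpL_natural, CategoryTheory.Functor.map_id]

theorem νpL_natural_right (hF : F.IsLinear) (A : X) {B B' : X} (g : B ⟶ B') :
    (𝟙 (F.Fp.obj A) ⊗ₕ F.Ft.map g) ≫ F.νpL A B' = F.νpL A B ≫ F.Fp.map (𝟙 A ⊗ₕ g) := by
  rw [← hF.νpL_natural, CategoryTheory.Functor.map_id]

end IsLinear

end Naturality

section Comp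

variable {X : Type u} [Category.{v} X] {Y : Type u} [Category.{v} Y] {Z : Type u} [Category.{v} Z]
  [LDC X] [LDC Y] [LDC Z]

/-- The composite of linear functors: the part of `MedialFunctorData.comp` that does not involve
the additional (co)monoidal structures. -/
def comp (F : LinearFunctorData X Y) (G : LinearFunctorData Y Z) : LinearFunctorData X Z where
  Ft := F.Ft ⋙ G.Ft
  Fp := F.Fp ⋙ G.Fp
  tLax := @Functor.LaxMonoidal.comp _ _ TwoMonoidal.ten _ _ TwoMonoidal.ten _ _ TwoMonoidal.ten
    F.Ft G.Ft F.tLax G.tLax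
  pOplax := @Functor.OplaxMonoidal.comp _ _ TwoMonoidal.par _ _ TwoMonoidal.par _ _ TwoMonoidal.par
    F.Fp G.Fp F.pOplax G.pOplax
  νtR A B := G.Ft.map (F.νtR A B) ≫ G.νtR (F.Fp.obj A) (F.Ft.obj B)
  νtL A B := G.Ft.map (F.νtL A B) ≫ G.νtL (F.Ft.obj A) (F.Fp.obj B)
  νpR A B := G.νpR (F.Ft.obj A) (F.Fp.obj B) ≫ G.Fp.map (F.νpR A B)
  νpL A B := G.νpL (F.Fp.obj A) (F.Ft.obj B) ≫ G.Fp.map (F.νpL A B)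

variable (F : LinearFunctorData X Y) (G : LinearFunctorData Y Z)

theorem comp_Ft : (F.comp G).Ft = F.Ft ⋙ G.Ft := rfl
theorem comp_Fp : (F.comp G).Fp = F.Fp ⋙ G.Fp := rfl
theorem comp_mTop : (F.comp G).mTop = G.mTop ≫ G.Ft.map F.mTop := rfl
theorem comp_mTen (A B : X) : (F.comp G).mTen A B = G.mTen _ _ ≫ G.Ft.map (F.mTen A B) := rfl
theorem comp_nBot : (F.comp G).nBot = G.Fp.map F.nBot ≫ G.nBot := rfl
theorem comp_nPar (A B : X) : (F.comp G).nPar A B = G.Fp.map (F.nPar A B) ≫ G.nPar _ _ := rfl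
theorem comp_νtR (A B : X) : (F.comp G).νtR A B = G.Ft.map (F.νtR A B) ≫ G.νtR _ _ := rfl
theorem comp_νtL (A B : X) : (F.comp G).νtL A B = G.Ft.map (F.νtL A B) ≫ G.νtL _ _ := rfl
theorem comp_νpR (A B : X) : (F.comp G).νpR A B = G.νpR _ _ ≫ G.Fp.map (F.νpR A B) := rfl
theorem comp_νpL (A B : X) : (F.comp G).νpL A B = G.νpL _ _ ≫ G.Fp.map (F.νpL A B) := rfl

variable {F G}

namespace IsLinear

theorem comp_νtR_natural (hF : F.IsLinear) (hG : G.IsLinear) {A A' B B' : X} (f : A ⟶ A')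
    (g : B ⟶ B') :
    (F.comp G).Ft.map (f ⊕ₕ g) ≫ (F.comp G).νtR A' B' =
      (F.comp G).νtR A B ≫ ((F.comp G).Fp.map f ⊕ₕ (F.comp G).Ft.map g) := by
  simp only [comp_Ft, comp_Fp, comp_νtR, Functor.comp_map, Category.assoc]
  rw [← hG.νtR_natural]
  simp only [← Functor.map_comp_assoc, hF.νtR_natural]

theorem comp_νtL_natural (hF : F.IsLinear) (hG : G.IsLinear) {A A' B B' : X} (f : A ⟶ A')
    (g : B ⟶ B') :
    (F.comp G).Ft.map (f ⊕ₕ g) ≫ (F.comp G).νtL A' B' =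
      (F.comp G).νtL A B ≫ ((F.comp G).Ft.map f ⊕ₕ (F.comp G).Fp.map g) := by
  simp only [comp_Ft, comp_Fp, comp_νtL, Functor.comp_map, Category.assoc]
  rw [← hG.νtL_natural]
  simp only [← Functor.map_comp_assoc, hF.νtL_natural]

theorem comp_νpR_natural (hF : F.IsLinear) (hG : G.IsLinear) {A A' B B' : X} (f : A ⟶ A')
    (g : B ⟶ B') :
    ((F.comp G).Ft.map f ⊗ₕ (F.comp G).Fp.map g) ≫ (F.comp G).νpR A' B' =
      (F.comp G).νpR A B ≫ (F.comp G).Fp.map (f ⊗ₕ g) := by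
  simp only [comp_Ft, comp_Fp, comp_νpR, Functor.comp_map, Category.assoc]
  rw [reassoc_of% (@hG.νpR_natural)]
  simp only [← Functor.map_comp, hF.νpR_natural]

theorem comp_νpL_natural (hF : F.IsLinear) (hG : G.IsLinear) {A A' B B' : X} (f : A ⟶ A')
    (g : B ⟶ B') :
    ((F.comp G).Fp.map f ⊗ₕ (F.comp G).Ft.map g) ≫ (F.comp G).νpL A' B' =
      (F.comp G).νpL A B ≫ (F.comp G).Fp.map (f ⊗ₕ g) := by
  simp only [comp_Ft, comp_Fp, comp_νpL, Functor.comp_map, Category.assoc]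
  rw [reassoc_of% (@hG.νpL_natural)]
  simp only [← Functor.map_comp, hF.νpL_natural]

theorem comp_νtR_unit (hF : F.IsLinear) (hG : G.IsLinear) (A : X) :
    (F.comp G).νtR (bot X) A ≫ ((F.comp G).nBot ⊕ₕ 𝟙 ((F.comp G).Ft.obj A)) ≫ (pL _).hom =
      (F.comp G).Ft.map (pL A).hom := by
  simp only [comp_Ft, comp_Fp, comp_νtR, comp_nBot, Functor.comp_obj, Functor.comp_map,
    comp_pHom_id, Category.assoc]
  rw [← reassoc_of% hG.νtR_natural_left, hG.νtR_unit]
  simp only [← Functor.map_comp, hF.νtR_unit]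

theorem comp_νtL_unit (hF : F.IsLinear) (hG : G.IsLinear) (A : X) :
    (F.comp G).νtL A (bot X) ≫ (𝟙 ((F.comp G).Ft.obj A) ⊕ₕ (F.comp G).nBot) ≫ (pR _).hom =
      (F.comp G).Ft.map (pR A).hom := by
  simp only [comp_Ft, comp_Fp, comp_νtL, comp_nBot, Functor.comp_obj, Functor.comp_map,
    id_pHom_comp, Category.assoc]
  rw [← reassoc_of% hG.νtL_natural_right, hG.νtL_unit]
  simp only [← Functor.map_comp, hF.νtL_unit]

theorem comp_νpR_unit (hF : F.IsLinear) (hG : G.IsLinear) (A : X) :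
    (tL _).hom ≫ ((F.comp G).mTop ⊗ₕ 𝟙 ((F.comp G).Fp.obj A)) ≫ (F.comp G).νpR (top X) A =
      (F.comp G).Fp.map (tL A).hom := by
  simp only [comp_Ft, comp_Fp, comp_νpR, comp_mTop, Functor.comp_obj, Functor.comp_map,
    comp_tHom_id, Category.assoc]
  rw [reassoc_of% (@hG.νpR_natural_left), reassoc_of% hG.νpR_unit]
  simp only [← Functor.map_comp, hF.νpR_unit]

theorem comp_νpL_unit (hF : F.IsLinear) (hG : G.IsLinear) (A : X) :
    (tR _).hom ≫ (𝟙 ((F.comp G).Fp.obj A) ⊗ₕ (F.comp G).mTop) ≫ (F.comp G).νpL A (top X) =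
      (F.comp G).Fp.map (tR A).hom := by
  simp only [comp_Ft, comp_Fp, comp_νpL, comp_mTop, Functor.comp_obj, Functor.comp_map,
    id_tHom_comp, Category.assoc]
  rw [reassoc_of% (@hG.νpL_natural_right), reassoc_of% hG.νpL_unit]
  simp only [← Functor.map_comp, hF.νpL_unit]

theorem comp_νtR_assoc (hF : F.IsLinear) (hG : G.IsLinear) (A B C : X) :
    (F.comp G).νtR A (B ⊕ₒ C) ≫ (𝟙 _ ⊕ₕ (F.comp G).νtR B C) ≫ (pAssoc _ _ _).hom =
      (F.comp G).Ft.map (pAssoc A B C).hom ≫ (F.comp G).νtR (A ⊕ₒ B) C ≫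
        ((F.comp G).nPar A B ⊕ₕ 𝟙 _) := by
  simp only [comp_Ft, comp_Fp, comp_νtR, comp_nPar, Functor.comp_obj, Functor.comp_map,
    id_pHom_comp, comp_pHom_id, Category.assoc]
  rw [← reassoc_of% hG.νtR_natural_right, hG.νtR_assoc, ← reassoc_of% hG.νtR_natural_left]
  simp only [← Functor.map_comp_assoc, hF.νtR_assoc]

theorem comp_νtL_assoc (hF : F.IsLinear) (hG : G.IsLinear) (A B C : X) :
    (F.comp G).νtL A (B ⊕ₒ C) ≫ (𝟙 _ ⊕ₕ (F.comp G).nPar B C) ≫ (pAssoc _ _ _).hom =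
      (F.comp G).Ft.map (pAssoc A B C).hom ≫ (F.comp G).νtL (A ⊕ₒ B) C ≫
        ((F.comp G).νtL A B ⊕ₕ 𝟙 _) := by
  simp only [comp_Ft, comp_Fp, comp_νtL, comp_nPar, Functor.comp_obj, Functor.comp_map,
    id_pHom_comp, comp_pHom_id, Category.assoc]
  rw [← reassoc_of% hG.νtL_natural_right, hG.νtL_assoc, ← reassoc_of% hG.νtL_natural_left]
  simp only [← Functor.map_comp_assoc, hF.νtL_assoc]

theorem comp_νpR_assoc (hF : F.IsLinear) (hG : G.IsLinear) (A B C : X) :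
    (tAssoc _ _ _).hom ≫ (𝟙 _ ⊗ₕ (F.comp G).νpR B C) ≫ (F.comp G).νpR A (B ⊗ₒ C) =
      ((F.comp G).mTen A B ⊗ₕ 𝟙 _) ≫ (F.comp G).νpR (A ⊗ₒ B) C ≫
        (F.comp G).Fp.map (tAssoc A B C).hom := by
  simp only [comp_Ft, comp_Fp, comp_νpR, comp_mTen, Functor.comp_obj, Functor.comp_map,
    id_tHom_comp, comp_tHom_id, Category.assoc]
  rw [reassoc_of% (@hG.νpR_natural_right), reassoc_of% (@hG.νpR_assoc),
    reassoc_of% (@hG.νpR_natural_left)]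
  simp only [← Functor.map_comp, hF.νpR_assoc]

theorem comp_νpL_assoc (hF : F.IsLinear) (hG : G.IsLinear) (A B C : X) :
    (tAssoc _ _ _).hom ≫ (𝟙 _ ⊗ₕ (F.comp G).mTen B C) ≫ (F.comp G).νpL A (B ⊗ₒ C) =
      ((F.comp G).νpL A B ⊗ₕ 𝟙 _) ≫ (F.comp G).νpL (A ⊗ₒ B) C ≫
        (F.comp G).Fp.map (tAssoc A B C).hom := by
  simp only [comp_Ft, comp_Fp, comp_νpL, comp_mTen, Functor.comp_obj, Functor.comp_map,
    id_tHom_comp, comp_tHom_id, Category.assoc]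
  rw [reassoc_of% (@hG.νpL_natural_right), reassoc_of% (@hG.νpL_assoc),
    reassoc_of% (@hG.νpL_natural_left)]
  simp only [← Functor.map_comp, hF.νpL_assoc]

theorem comp_νtR_δR (hF : F.IsLinear) (hG : G.IsLinear) (A B C : X) :
    (F.comp G).mTen (A ⊕ₒ B) C ≫ (F.comp G).Ft.map (δR A B C) ≫ (F.comp G).νtR A (B ⊗ₒ C) =
      ((F.comp G).νtR A B ⊗ₕ 𝟙 _) ≫ δR _ _ _ ≫ (𝟙 _ ⊕ₕ (F.comp G).mTen B C) := by
  simp only [comp_Ft, comp_Fp, comp_νtR, comp_mTen, Functor.comp_obj, Functor.comp_map,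
    comp_tHom_id, id_pHom_comp, Category.assoc]
  rw [← reassoc_of% hG.νtR_δR, ← hG.νtR_natural_right, reassoc_of% G.mTen_natural_left]
  simp only [← Functor.map_comp_assoc, hF.νtR_δR]

theorem comp_νtL_δL (hF : F.IsLinear) (hG : G.IsLinear) (A B C : X) :
    (F.comp G).mTen A (B ⊕ₒ C) ≫ (F.comp G).Ft.map (δL A B C) ≫ (F.comp G).νtL (A ⊗ₒ B) C =
      (𝟙 _ ⊗ₕ (F.comp G).νtL B C) ≫ δL _ _ _ ≫ ((F.comp G).mTen A B ⊕ₕ 𝟙 _) := by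
  simp only [comp_Ft, comp_Fp, comp_νtL, comp_mTen, Functor.comp_obj, Functor.comp_map,
    id_tHom_comp, comp_pHom_id, Category.assoc]
  rw [← reassoc_of% hG.νtL_δL, ← hG.νtL_natural_left, reassoc_of% G.mTen_natural_right]
  simp only [← Functor.map_comp_assoc, hF.νtL_δL]

theorem comp_νpR_δL (hF : F.IsLinear) (hG : G.IsLinear) (A B C : X) :
    (F.comp G).νpR A (B ⊕ₒ C) ≫ (F.comp G).Fp.map (δL A B C) ≫ (F.comp G).nPar (A ⊗ₒ B) C =
      (𝟙 _ ⊗ₕ (F.comp G).nPar B C) ≫ δL _ _ _ ≫ ((F.comp G).νpR A B ⊕ₕ 𝟙 _) := by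
  simp only [comp_Ft, comp_Fp, comp_νpR, comp_nPar, Functor.comp_obj, Functor.comp_map,
    id_tHom_comp, comp_pHom_id, Category.assoc]
  rw [← reassoc_of% hG.νpR_δL, ← G.nPar_natural_left, reassoc_of% (@hG.νpR_natural_right)]
  simp only [← Functor.map_comp_assoc, hF.νpR_δL]

theorem comp_νpL_δR (hF : F.IsLinear) (hG : G.IsLinear) (A B C : X) :
    (F.comp G).νpL (A ⊕ₒ B) C ≫ (F.comp G).Fp.map (δR A B C) ≫ (F.comp G).nPar A (B ⊗ₒ C) =
      ((F.comp G).nPar A B ⊗ₕ 𝟙 _) ≫ δR _ _ _ ≫ (𝟙 _ ⊕ₕ (F.comp G).νpL B C) := by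
  simp only [comp_Ft, comp_Fp, comp_νpL, comp_nPar, Functor.comp_obj, Functor.comp_map,
    comp_tHom_id, id_pHom_comp, Category.assoc]
  rw [← reassoc_of% hG.νpL_δR, ← G.nPar_natural_right, reassoc_of% (@hG.νpL_natural_left)]
  simp only [← Functor.map_comp_assoc, hF.νpL_δR]

theorem comp_νtR_νtL (hF : F.IsLinear) (hG : G.IsLinear) (A B C : X) :
    (F.comp G).νtR A (B ⊕ₒ C) ≫ (𝟙 _ ⊕ₕ (F.comp G).νtL B C) ≫ (pAssoc _ _ _).hom =
      (F.comp G).Ft.map (pAssoc A B C).hom ≫ (F.comp G).νtL (A ⊕ₒ B) C ≫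
        ((F.comp G).νtR A B ⊕ₕ 𝟙 _) := by
  simp only [comp_Ft, comp_Fp, comp_νtR, comp_νtL, Functor.comp_obj, Functor.comp_map,
    id_pHom_comp, comp_pHom_id, Category.assoc]
  rw [← reassoc_of% hG.νtR_natural_right, hG.νtR_νtL, ← reassoc_of% hG.νtL_natural_left]
  simp only [← Functor.map_comp_assoc, hF.νtR_νtL]

theorem comp_νpL_νpR (hF : F.IsLinear) (hG : G.IsLinear) (A B C : X) :
    (tAssoc _ _ _).hom ≫ (𝟙 _ ⊗ₕ (F.comp G).νpL B C) ≫ (F.comp G).νpR A (B ⊗ₒ C) =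
      ((F.comp G).νpR A B ⊗ₕ 𝟙 _) ≫ (F.comp G).νpL (A ⊗ₒ B) C ≫
        (F.comp G).Fp.map (tAssoc A B C).hom := by
  simp only [comp_Ft, comp_Fp, comp_νpR, comp_νpL, Functor.comp_obj, Functor.comp_map,
    id_tHom_comp, comp_tHom_id, Category.assoc]
  rw [reassoc_of% (@hG.νpR_natural_right), reassoc_of% (@hG.νpL_νpR),
    reassoc_of% (@hG.νpL_natural_left)]
  simp only [← Functor.map_comp, hF.νpL_νpR]

theorem comp_νtR_δL (hF : F.IsLinear) (hG : G.IsLinear) (A B C : X) :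
    (F.comp G).mTen A (B ⊕ₒ C) ≫ (F.comp G).Ft.map (δL A B C) ≫ (F.comp G).νtR (A ⊗ₒ B) C =
      (𝟙 _ ⊗ₕ (F.comp G).νtR B C) ≫ δL _ _ _ ≫ ((F.comp G).νpR A B ⊕ₕ 𝟙 _) := by
  simp only [comp_Ft, comp_Fp, comp_νtR, comp_νpR, comp_mTen, Functor.comp_obj, Functor.comp_map,
    id_tHom_comp, comp_pHom_id, Category.assoc]
  rw [← reassoc_of% hG.νtR_δL, ← hG.νtR_natural_left, reassoc_of% G.mTen_natural_right]
  simp only [← Functor.map_comp_assoc, hF.νtR_δL]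

theorem comp_νtL_δR (hF : F.IsLinear) (hG : G.IsLinear) (A B C : X) :
    (F.comp G).mTen (A ⊕ₒ B) C ≫ (F.comp G).Ft.map (δR A B C) ≫ (F.comp G).νtL A (B ⊗ₒ C) =
      ((F.comp G).νtL A B ⊗ₕ 𝟙 _) ≫ δR _ _ _ ≫ (𝟙 _ ⊕ₕ (F.comp G).νpL B C) := by
  simp only [comp_Ft, comp_Fp, comp_νtL, comp_νpL, comp_mTen, Functor.comp_obj, Functor.comp_map,
    comp_tHom_id, id_pHom_comp, Category.assoc]
  rw [← reassoc_of% hG.νtL_δR, ← hG.νtL_natural_right, reassoc_of% G.mTen_natural_left]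
  simp only [← Functor.map_comp_assoc, hF.νtL_δR]

theorem comp_νpR_δR (hF : F.IsLinear) (hG : G.IsLinear) (A B C : X) :
    (F.comp G).νpR (A ⊕ₒ B) C ≫ (F.comp G).Fp.map (δR A B C) ≫ (F.comp G).nPar A (B ⊗ₒ C) =
      ((F.comp G).νtR A B ⊗ₕ 𝟙 _) ≫ δR _ _ _ ≫ (𝟙 _ ⊕ₕ (F.comp G).νpR B C) := by
  simp only [comp_Ft, comp_Fp, comp_νtR, comp_νpR, comp_nPar, Functor.comp_obj, Functor.comp_map,
    comp_tHom_id, id_pHom_comp, Category.assoc]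
  rw [← reassoc_of% hG.νpR_δR, ← G.nPar_natural_right, reassoc_of% (@hG.νpR_natural_left)]
  simp only [← Functor.map_comp_assoc, hF.νpR_δR]

theorem comp_νpL_δL (hF : F.IsLinear) (hG : G.IsLinear) (A B C : X) :
    (F.comp G).νpL A (B ⊕ₒ C) ≫ (F.comp G).Fp.map (δL A B C) ≫ (F.comp G).nPar (A ⊗ₒ B) C =
      (𝟙 _ ⊗ₕ (F.comp G).νtL B C) ≫ δL _ _ _ ≫ ((F.comp G).νpL A B ⊕ₕ 𝟙 _) := by
  simp only [comp_Ft, comp_Fp, comp_νtL, comp_νpL, comp_nPar, Functor.comp_obj, Functor.comp_map,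
    id_tHom_comp, comp_pHom_id, Category.assoc]
  rw [← reassoc_of% hG.νpL_δL, ← G.nPar_natural_left, reassoc_of% (@hG.νpL_natural_right)]
  simp only [← Functor.map_comp_assoc, hF.νpL_δL]

theorem comp (hF : F.IsLinear) (hG : G.IsLinear) : (F.comp G).IsLinear where
  νtR_natural := hF.comp_νtR_natural hG
  νtL_natural := hF.comp_νtL_natural hG
  νpR_natural := hF.comp_νpR_natural hG
  νpL_natural := hF.comp_νpL_natural hG
  νtR_unit := hF.comp_νtR_unit hG
  νtL_unit := hF.comp_νtL_unit hG
  νpR_unit := hF.comp_νpR_unit hG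
  νpL_unit := hF.comp_νpL_unit hG
  νtR_assoc := hF.comp_νtR_assoc hG
  νtL_assoc := hF.comp_νtL_assoc hG
  νpR_assoc := hF.comp_νpR_assoc hG
  νpL_assoc := hF.comp_νpL_assoc hG
  νtR_δR := hF.comp_νtR_δR hG
  νtL_δL := hF.comp_νtL_δL hG
  νpR_δL := hF.comp_νpR_δL hG
  νpL_δR := hF.comp_νpL_δR hG
  νtR_νtL := hF.comp_νtR_νtL hG
  νpL_νpR := hF.comp_νpL_νpR hG
  νtR_δL := hF.comp_νtR_δL hG
  νtL_δR := hF.comp_νtL_δR hG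
  νpR_δR := hF.comp_νpR_δR hG
  νpL_δL := hF.comp_νpL_δL hG

end IsLinear

end Comp

namespace IsSymmetric

variable {X : Type u} [Category.{v} X] {Y : Type u} [Category.{v} Y] {Z : Type u} [Category.{v} Z]
  [SymmetricMLDC X] [SymmetricMLDC Y] [SymmetricMLDC Z]

theorem comp {F : LinearFunctorData X Y} {G : LinearFunctorData Y Z} (hF : F.IsSymmetric)
    (hG : G.IsSymmetric) : (F.comp G).IsSymmetric where
  mTen_braid A B := by
    simp only [comp_Ft, comp_mTen, Functor.comp_obj, Functor.comp_map, Category.assoc]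
    rw [← reassoc_of% hG.mTen_braid]
    simp only [← Functor.map_comp, hF.mTen_braid]
  nPar_braid A B := by
    simp only [comp_Fp, comp_nPar, Functor.comp_obj, Functor.comp_map, Category.assoc]
    rw [← hG.nPar_braid]
    simp only [← Functor.map_comp_assoc, hF.nPar_braid]
  νt_braid A B := by
    simp only [comp_Ft, comp_Fp, comp_νtR, comp_νtL, Functor.comp_obj, Functor.comp_map,
      Category.assoc]
    rw [hG.νt_braid]
    simp only [← Functor.map_comp_assoc, hF.νt_braid]
  νp_braid A B := by
    simp only [comp_Ft, comp_Fp, comp_νpR, comp_νpL, Functor.comp_obj, Functor.comp_map,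
      Category.assoc]
    rw [← reassoc_of% hG.νp_braid]
    simp only [← Functor.map_comp, hF.νp_braid]

end IsSymmetric

section Id

variable (X : Type u) [Category.{v} X]

/-- The identity linear functor: the part of `MedialFunctorData.id` that does not involve the
additional (co)monoidal structures. -/
def id [LDC X] : LinearFunctorData X X where
  Ft := 𝟭 X
  Fp := 𝟭 X
  tLax := @Functor.LaxMonoidal.id X _ TwoMonoidal.ten
  pOplax := @Functor.OplaxMonoidal.id X _ TwoMonoidal.par
  νtR A B := 𝟙 (A ⊕ₒ B)
  νtL A B := 𝟙 (A ⊕ₒ B)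
  νpR A B := 𝟙 (A ⊗ₒ B)
  νpL A B := 𝟙 (A ⊗ₒ B)

section

variable [LDC X]

theorem id_Ft : (id X).Ft = 𝟭 X := rfl
theorem id_Fp : (id X).Fp = 𝟭 X := rfl
theorem id_mTop : (id X).mTop = 𝟙 (top X) := rfl
theorem id_mTen (A B : X) : (id X).mTen A B = 𝟙 (A ⊗ₒ B) := rfl
theorem id_nBot : (id X).nBot = 𝟙 (bot X) := rfl
theorem id_nPar (A B : X) : (id X).nPar A B = 𝟙 (A ⊕ₒ B) := rfl
theorem id_νtR (A B : X) : (id X).νtR A B = 𝟙 (A ⊕ₒ B) := rfl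
theorem id_νtL (A B : X) : (id X).νtL A B = 𝟙 (A ⊕ₒ B) := rfl
theorem id_νpR (A B : X) : (id X).νpR A B = 𝟙 (A ⊗ₒ B) := rfl
theorem id_νpL (A B : X) : (id X).νpL A B = 𝟙 (A ⊗ₒ B) := rfl

theorem IsLinear.id : (id X).IsLinear := by
  constructor <;> intros <;>
    simp only [id_Ft, id_Fp, id_mTop, id_mTen, id_nBot, id_nPar, id_νtR, id_νtL, id_νpR, id_νpL,
      Functor.id_obj, Functor.id_map, id_tHom_id, id_pHom_id, Category.id_comp, Category.comp_id]

end

theorem IsSymmetric.id [SymmetricMLDC X] : (id X).IsSymmetric := by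
  constructor <;> intros <;>
    simp only [id_Ft, id_Fp, id_mTen, id_nPar, id_νtR, id_νtL, id_νpR, id_νpL,
      Functor.id_obj, Functor.id_map, Category.id_comp, Category.comp_id]

end Id

end LinearFunctorData

/-! ### Composition of medial linear functors -/

namespace MedialFunctorData

section Id

open LinearFunctorData (id_Ft id_Fp id_mTop id_mTen id_nBot id_nPar id_νtR id_νpR)

variable (X : Type u) [Category.{v} X]

section

variable [LDC X]

theorem id_toLinearFunctorData : (id X).toLinearFunctorData = LinearFunctorData.id X := rfl
theorem id_mBot : (id X).mBot = 𝟙 (bot X) := rfl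
theorem id_mPar (A B : X) : (id X).mPar A B = 𝟙 (A ⊕ₒ B) := rfl
theorem id_nTop : (id X).nTop = 𝟙 (top X) := rfl
theorem id_nTen (A B : X) : (id X).nTen A B = 𝟙 (A ⊗ₒ B) := rfl

end

theorem IsMedial.id [SymmetricMLDC X] : (id X).IsMedial := by
  constructor
  case isLinear => exact LinearFunctorData.IsLinear.id X
  case isSymmetric => exact LinearFunctorData.IsSymmetric.id X
  case mTop_iso => exact inferInstanceAs (IsIso (𝟙 (top X)))
  case mTen_iso => exact fun A B => inferInstanceAs (IsIso (𝟙 (A ⊗ₒ B)))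
  case nBot_iso => exact inferInstanceAs (IsIso (𝟙 (bot X)))
  case nPar_iso => exact fun A B => inferInstanceAs (IsIso (𝟙 (A ⊕ₒ B)))
  all_goals
    intros
    simp only [id_toLinearFunctorData, id_mBot, id_mPar, id_nTop, id_nTen, id_Ft, id_Fp, id_mTop,
      id_mTen, id_nBot, id_nPar, id_νtR, id_νpR, IsIso.inv_id, Functor.id_obj, Functor.id_map,
      id_tHom_id, id_pHom_id, Category.id_comp, Category.comp_id]

end Id

section Naturality

variable {X : Type u} [Category.{v} X] {Y : Type u} [Category.{v} Y] [LDC X] [LDC Y]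
  (F : MedialFunctorData X Y)

theorem mPar_natural {A A' B B' : X} (f : A ⟶ A') (g : B ⟶ B') :
    (F.Ft.map f ⊕ₕ F.Ft.map g) ≫ F.mPar A' B' = F.mPar A B ≫ F.Ft.map (f ⊕ₕ g) :=
  @Functor.LaxMonoidal.μ_natural _ _ TwoMonoidal.par _ _ TwoMonoidal.par F.Ft F.pLax _ _ _ _ f g

theorem nTen_natural {A A' B B' : X} (f : A ⟶ A') (g : B ⟶ B') :
    F.Fp.map (f ⊗ₕ g) ≫ F.nTen A' B' = F.nTen A B ≫ (F.Fp.map f ⊗ₕ F.Fp.map g) :=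
  (@Functor.OplaxMonoidal.δ_natural _ _ TwoMonoidal.ten _ _ TwoMonoidal.ten F.Fp F.tOplax
    _ _ _ _ f g).symm

theorem mPar_natural_left {A A' : X} (f : A ⟶ A') (B : X) :
    (F.Ft.map f ⊕ₕ 𝟙 (F.Ft.obj B)) ≫ F.mPar A' B = F.mPar A B ≫ F.Ft.map (f ⊕ₕ 𝟙 B) := by
  rw [← F.mPar_natural, CategoryTheory.Functor.map_id]

theorem nTen_natural_left {A A' : X} (f : A ⟶ A') (B : X) :
    F.Fp.map (f ⊗ₕ 𝟙 B) ≫ F.nTen A' B = F.nTen A B ≫ (F.Fp.map f ⊗ₕ 𝟙 (F.Fp.obj B)) := by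
  rw [F.nTen_natural, CategoryTheory.Functor.map_id]

end Naturality

section Comp

open LinearFunctorData (comp_Ft comp_Fp comp_mTop comp_mTen comp_nBot comp_nPar comp_νtR comp_νpR)

variable {X : Type u} [Category.{v} X] {Y : Type u} [Category.{v} Y] {Z : Type u} [Category.{v} Z]

section

variable [LDC X] [LDC Y] [LDC Z] (F : MedialFunctorData X Y) (G : MedialFunctorData Y Z)

theorem comp_toLinearFunctorData :
    (F.comp G).toLinearFunctorData = F.toLinearFunctorData.comp G.toLinearFunctorData := rfl

theorem comp_mBot : (F.comp G).mBot = G.mBot ≫ G.Ft.map F.mBot := rfl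
theorem comp_mPar (A B : X) : (F.comp G).mPar A B = G.mPar _ _ ≫ G.Ft.map (F.mPar A B) := rfl
theorem comp_nTop : (F.comp G).nTop = G.Fp.map F.nTop ≫ G.nTop := rfl
theorem comp_nTen (A B : X) : (F.comp G).nTen A B = G.Fp.map (F.nTen A B) ≫ G.nTen _ _ := rfl

end

namespace IsMedial

variable [SymmetricMLDC X] [SymmetricMLDC Y] [SymmetricMLDC Z]
  {F : MedialFunctorData X Y} {G : MedialFunctorData Y Z}

theorem comp_mPar_braid (hF : F.IsMedial) (hG : G.IsMedial) (A B : X) :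
    (F.comp G).mPar A B ≫ (F.comp G).Ft.map (pBraid A B).hom =
      (pBraid _ _).hom ≫ (F.comp G).mPar B A := by
  simp only [comp_toLinearFunctorData, comp_Ft, comp_mPar, Functor.comp_obj, Functor.comp_map,
    Category.assoc]
  rw [← reassoc_of% hG.mPar_braid]
  simp only [← Functor.map_comp, hF.mPar_braid]

theorem comp_nTen_braid (hF : F.IsMedial) (hG : G.IsMedial) (A B : X) :
    (F.comp G).Fp.map (tBraid A B).hom ≫ (F.comp G).nTen B A =
      (F.comp G).nTen A B ≫ (tBraid _ _).hom := by
  simp only [comp_toLinearFunctorData, comp_Fp, comp_nTen, Functor.comp_obj, Functor.comp_map,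
    Category.assoc]
  rw [← hG.nTen_braid]
  simp only [← Functor.map_comp_assoc, hF.nTen_braid]

theorem comp_mBot_Δbot (hF : F.IsMedial) (hG : G.IsMedial) :
    Δbot ≫ ((F.comp G).mBot ⊗ₕ (F.comp G).mBot) ≫ (F.comp G).mTen (bot X) (bot X) =
      (F.comp G).mBot ≫ (F.comp G).Ft.map Δbot := by
  simp only [comp_toLinearFunctorData, comp_Ft, comp_mBot, comp_mTen, Functor.comp_obj,
    Functor.comp_map, ← tHom_comp_tHom, Category.assoc]
  rw [reassoc_of% (@G.mTen_natural), reassoc_of% hG.mBot_Δbot]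
  simp only [← Functor.map_comp, hF.mBot_Δbot]

theorem comp_mTop_nablaTop (hF : F.IsMedial) (hG : G.IsMedial) :
    ((F.comp G).mTop ⊕ₕ (F.comp G).mTop) ≫ (F.comp G).mPar (top X) (top X) ≫
      (F.comp G).Ft.map nablaTop = nablaTop ≫ (F.comp G).mTop := by
  simp only [comp_toLinearFunctorData, comp_Ft, comp_mTop, comp_mPar, Functor.comp_obj,
    Functor.comp_map, ← pHom_comp_pHom, Category.assoc]
  rw [reassoc_of% (@G.mPar_natural), ← reassoc_of% hG.mTop_nablaTop]
  simp only [← Functor.map_comp, hF.mTop_nablaTop]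

theorem comp_mix_mTop (hF : F.IsMedial) (hG : G.IsMedial) :
    mix ≫ (F.comp G).mTop = (F.comp G).mBot ≫ (F.comp G).Ft.map mix := by
  simp only [comp_toLinearFunctorData, comp_Ft, comp_mTop, comp_mBot, Functor.comp_obj,
    Functor.comp_map, Category.assoc]
  rw [reassoc_of% hG.mix_mTop]
  simp only [← Functor.map_comp, hF.mix_mTop]

theorem comp_mTen_μ (hF : F.IsMedial) (hG : G.IsMedial) (A B C D : X) :
    ((F.comp G).mTen A B ⊕ₕ (F.comp G).mTen C D) ≫ (F.comp G).mPar (A ⊗ₒ B) (C ⊗ₒ D) ≫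
        (F.comp G).Ft.map (μ A B C D) =
      μ _ _ _ _ ≫ ((F.comp G).mPar A C ⊗ₕ (F.comp G).mPar B D) ≫
        (F.comp G).mTen (A ⊕ₒ C) (B ⊕ₒ D) := by
  simp only [comp_toLinearFunctorData, comp_Ft, comp_mTen, comp_mPar, Functor.comp_obj,
    Functor.comp_map, ← tHom_comp_tHom, ← pHom_comp_pHom, Category.assoc]
  rw [reassoc_of% (@G.mPar_natural), reassoc_of% (@G.mTen_natural), ← reassoc_of% hG.mTen_μ]
  simp only [← Functor.map_comp, hF.mTen_μ]

theorem comp_nBot_Δbot (hF : F.IsMedial) (hG : G.IsMedial) :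
    (F.comp G).Fp.map Δbot ≫ (F.comp G).nTen (bot X) (bot X) ≫
      ((F.comp G).nBot ⊗ₕ (F.comp G).nBot) = (F.comp G).nBot ≫ Δbot := by
  simp only [comp_toLinearFunctorData, comp_Fp, comp_nBot, comp_nTen, Functor.comp_obj,
    Functor.comp_map, ← tHom_comp_tHom, Category.assoc]
  rw [← reassoc_of% G.nTen_natural, ← hG.nBot_Δbot]
  simp only [← Functor.map_comp_assoc, hF.nBot_Δbot]

theorem comp_nTop_nablaTop (hF : F.IsMedial) (hG : G.IsMedial) :
    (F.comp G).nPar (top X) (top X) ≫ ((F.comp G).nTop ⊕ₕ (F.comp G).nTop) ≫ nablaTop =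
      (F.comp G).Fp.map nablaTop ≫ (F.comp G).nTop := by
  simp only [comp_toLinearFunctorData, comp_Fp, comp_nTop, comp_nPar, Functor.comp_obj,
    Functor.comp_map, ← pHom_comp_pHom, Category.assoc]
  rw [← reassoc_of% G.nPar_natural, hG.nTop_nablaTop]
  simp only [← Functor.map_comp_assoc, hF.nTop_nablaTop]

theorem comp_nBot_mix (hF : F.IsMedial) (hG : G.IsMedial) :
    (F.comp G).nBot ≫ mix = (F.comp G).Fp.map mix ≫ (F.comp G).nTop := by
  simp only [comp_toLinearFunctorData, comp_Fp, comp_nBot, comp_nTop, Functor.comp_obj,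
    Functor.comp_map, Category.assoc]
  rw [hG.nBot_mix]
  simp only [← Functor.map_comp_assoc, hF.nBot_mix]

theorem comp_nPar_μ (hF : F.IsMedial) (hG : G.IsMedial) (A B C D : X) :
    (F.comp G).Fp.map (μ A B C D) ≫ (F.comp G).nTen (A ⊕ₒ C) (B ⊕ₒ D) ≫
        ((F.comp G).nPar A C ⊗ₕ (F.comp G).nPar B D) =
      (F.comp G).nPar (A ⊗ₒ B) (C ⊗ₒ D) ≫ ((F.comp G).nTen A B ⊕ₕ (F.comp G).nTen C D) ≫
        μ _ _ _ _ := by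
  simp only [comp_toLinearFunctorData, comp_Fp, comp_nPar, comp_nTen, Functor.comp_obj,
    Functor.comp_map, ← tHom_comp_tHom, ← pHom_comp_pHom, Category.assoc]
  rw [← reassoc_of% G.nTen_natural, ← reassoc_of% G.nPar_natural, ← hG.nPar_μ]
  simp only [← Functor.map_comp_assoc, hF.nPar_μ]

theorem comp_νtR_mPar (hF : F.IsMedial) (hG : G.IsMedial) (A B C : X) :
    (F.comp G).mPar (A ⊕ₒ B) C ≫ (F.comp G).Ft.map (pAssoc A B C).inv ≫
        (F.comp G).νtR A (B ⊕ₒ C) =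
      ((F.comp G).νtR A B ⊕ₕ 𝟙 _) ≫ (pAssoc _ _ _).inv ≫ (𝟙 _ ⊕ₕ (F.comp G).mPar B C) := by
  simp only [comp_toLinearFunctorData, comp_Ft, comp_Fp, comp_νtR, comp_mPar, Functor.comp_obj,
    Functor.comp_map, comp_pHom_id, id_pHom_comp, Category.assoc]
  rw [← reassoc_of% hG.νtR_mPar, ← hG.isLinear.νtR_natural_right,
    reassoc_of% G.mPar_natural_left]
  simp only [← Functor.map_comp_assoc, hF.νtR_mPar]

theorem comp_νpR_nTen (hF : F.IsMedial) (hG : G.IsMedial) (A B C : X) :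
    (F.comp G).νpR A (B ⊗ₒ C) ≫ (F.comp G).Fp.map (tAssoc A B C).inv ≫
        (F.comp G).nTen (A ⊗ₒ B) C =
      (𝟙 _ ⊗ₕ (F.comp G).nTen B C) ≫ (tAssoc _ _ _).inv ≫ ((F.comp G).νpR A B ⊗ₕ 𝟙 _) := by
  simp only [comp_toLinearFunctorData, comp_Ft, comp_Fp, comp_νpR, comp_nTen, Functor.comp_obj,
    Functor.comp_map, comp_tHom_id, id_tHom_comp, Category.assoc]
  rw [← reassoc_of% hG.νpR_nTen, ← G.nTen_natural_left,
    reassoc_of% (@hG.isLinear.νpR_natural_right)]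
  simp only [← Functor.map_comp_assoc, hF.νpR_nTen]

theorem comp_νpR_Δbot (hF : F.IsMedial) (hG : G.IsMedial) [IsIso (F.comp G).nBot] :
    (F.comp G).Fp.map Δbot = (F.comp G).nBot ≫ Δbot ≫
      ((F.comp G).mBot ⊗ₕ inv (F.comp G).nBot) ≫ (F.comp G).νpR (bot X) (bot X) := by
  have := hF.nBot_iso
  have := hG.nBot_iso
  simp only [comp_toLinearFunctorData, comp_Ft, comp_Fp, comp_nBot, comp_mBot, comp_νpR,
    IsIso.inv_comp, ← Functor.map_inv, Functor.comp_obj, Functor.comp_map, ← tHom_comp_tHom,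
    Category.assoc]
  rw [reassoc_of% (@hG.isLinear.νpR_natural), ← reassoc_of% hG.νpR_Δbot]
  simp only [← Functor.map_comp, ← hF.νpR_Δbot]

theorem comp_νtR_nablaTop (hF : F.IsMedial) (hG : G.IsMedial) [IsIso (F.comp G).mTop] :
    (F.comp G).Ft.map nablaTop = (F.comp G).νtR (top X) (top X) ≫
      ((F.comp G).nTop ⊕ₕ inv (F.comp G).mTop) ≫ nablaTop ≫ (F.comp G).mTop := by
  have := hF.mTop_iso
  have := hG.mTop_iso
  simp only [comp_toLinearFunctorData, comp_Ft, comp_Fp, comp_mTop, comp_nTop, comp_νtR,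
    IsIso.inv_comp, ← Functor.map_inv, Functor.comp_obj, Functor.comp_map, ← pHom_comp_pHom,
    Category.assoc]
  rw [← reassoc_of% (@hG.isLinear.νtR_natural), ← reassoc_of% hG.νtR_nablaTop]
  simp only [← Functor.map_comp, ← hF.νtR_nablaTop]

theorem comp_νtR_μ (hF : F.IsMedial) (hG : G.IsMedial) [∀ A B : X, IsIso ((F.comp G).mTen A B)]
    (A B C D : X) :
    (F.comp G).Ft.map (μ A B C D) ≫ inv ((F.comp G).mTen (A ⊕ₒ C) (B ⊕ₒ D)) ≫
        ((F.comp G).νtR A C ⊗ₕ (F.comp G).νtR B D) =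
      (F.comp G).νtR (A ⊗ₒ B) (C ⊗ₒ D) ≫ ((F.comp G).nTen A B ⊕ₕ inv ((F.comp G).mTen C D)) ≫
        μ _ _ _ _ := by
  have := hF.mTen_iso
  have := hG.mTen_iso
  simp only [comp_toLinearFunctorData, comp_Ft, comp_Fp, comp_mTen, comp_nTen, comp_νtR,
    IsIso.inv_comp, ← Functor.map_inv, Functor.comp_obj, Functor.comp_map, ← tHom_comp_tHom,
    ← pHom_comp_pHom, Category.assoc]
  rw [reassoc_of% (@G.inv_mTen_natural), ← reassoc_of% (@hG.isLinear.νtR_natural), ← hG.νtR_μ]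
  simp only [← Functor.map_comp_assoc, hF.νtR_μ]

theorem comp_νpR_μ (hF : F.IsMedial) (hG : G.IsMedial) [∀ A B : X, IsIso ((F.comp G).nPar A B)]
    (A B C D : X) :
    ((F.comp G).νpR A B ⊕ₕ (F.comp G).νpR C D) ≫ inv ((F.comp G).nPar (A ⊗ₒ B) (C ⊗ₒ D)) ≫
        (F.comp G).Fp.map (μ A B C D) =
      μ _ _ _ _ ≫ ((F.comp G).mPar A C ⊗ₕ inv ((F.comp G).nPar B D)) ≫
        (F.comp G).νpR (A ⊕ₒ C) (B ⊕ₒ D) := by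
  have := hF.nPar_iso
  have := hG.nPar_iso
  simp only [comp_toLinearFunctorData, comp_Ft, comp_Fp, comp_nPar, comp_mPar, comp_νpR,
    IsIso.inv_comp, ← Functor.map_inv, Functor.comp_obj, Functor.comp_map, ← tHom_comp_tHom,
    ← pHom_comp_pHom, Category.assoc]
  rw [reassoc_of% (@G.inv_nPar_natural), reassoc_of% (@hG.isLinear.νpR_natural),
    ← reassoc_of% hG.νpR_μ]
  simp only [← Functor.map_comp, hF.νpR_μ]

theorem comp_mTop_iso (hF : F.IsMedial) (hG : G.IsMedial) : IsIso (F.comp G).mTop :=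
  have := hF.mTop_iso
  have := hG.mTop_iso
  inferInstanceAs (IsIso (G.mTop ≫ G.Ft.map F.mTop))

theorem comp_mTen_iso (hF : F.IsMedial) (hG : G.IsMedial) (A B : X) :
    IsIso ((F.comp G).mTen A B) :=
  have := hF.mTen_iso
  have := hG.mTen_iso
  inferInstanceAs (IsIso (G.mTen _ _ ≫ G.Ft.map (F.mTen A B)))

theorem comp_nBot_iso (hF : F.IsMedial) (hG : G.IsMedial) : IsIso (F.comp G).nBot :=
  have := hF.nBot_iso
  have := hG.nBot_iso
  inferInstanceAs (IsIso (G.Fp.map F.nBot ≫ G.nBot))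

theorem comp_nPar_iso (hF : F.IsMedial) (hG : G.IsMedial) (A B : X) :
    IsIso ((F.comp G).nPar A B) :=
  have := hF.nPar_iso
  have := hG.nPar_iso
  inferInstanceAs (IsIso (G.Fp.map (F.nPar A B) ≫ G.nPar _ _))

theorem comp (hF : F.IsMedial) (hG : G.IsMedial) : (F.comp G).IsMedial where
  isLinear := hF.isLinear.comp hG.isLinear
  isSymmetric := hF.isSymmetric.comp hG.isSymmetric
  mTop_iso := hF.comp_mTop_iso hG
  mTen_iso := hF.comp_mTen_iso hG
  nBot_iso := hF.comp_nBot_iso hG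
  nPar_iso := hF.comp_nPar_iso hG
  mPar_braid := hF.comp_mPar_braid hG
  nTen_braid := hF.comp_nTen_braid hG
  mBot_Δbot := hF.comp_mBot_Δbot hG
  mTop_nablaTop := hF.comp_mTop_nablaTop hG
  mix_mTop := hF.comp_mix_mTop hG
  mTen_μ := hF.comp_mTen_μ hG
  nBot_Δbot := hF.comp_nBot_Δbot hG
  nTop_nablaTop := hF.comp_nTop_nablaTop hG
  nBot_mix := hF.comp_nBot_mix hG
  nPar_μ := hF.comp_nPar_μ hG
  νpR_Δbot :=
    have := hF.comp_nBot_iso hG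
    hF.comp_νpR_Δbot hG
  νtR_nablaTop :=
    have := hF.comp_mTop_iso hG
    hF.comp_νtR_nablaTop hG
  νtR_μ :=
    have := hF.comp_mTen_iso hG
    hF.comp_νtR_μ hG
  νpR_μ :=
    have := hF.comp_nPar_iso hG
    hF.comp_νpR_μ hG
  νtR_mPar := hF.comp_νtR_mPar hG
  νpR_nTen := hF.comp_νpR_nTen hG

end IsMedial

end Comp

end MedialFunctorData

/-! ### Medial linear transformations -/

namespace TransData

open LinearFunctorData (comp_Ft comp_Fp comp_mTop comp_mTen comp_nBot comp_nPar comp_νtR comp_νtL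
  comp_νpR comp_νpL)
open MedialFunctorData (comp_toLinearFunctorData comp_mBot comp_mPar comp_nTop comp_nTen)

variable {X : Type u} [Category.{v} X] {Y : Type u} [Category.{v} Y] {Z : Type u} [Category.{v} Z]
  [LDC X] [LDC Y] [LDC Z]

namespace IsMedial

theorem id (F : MedialFunctorData X Y) : (TransData.id F).IsMedial := by
  constructor <;> intros <;>
    simp only [TransData.id, NatTrans.id_app, id_tHom_id, id_pHom_id, Category.id_comp,
      Category.comp_id]

theorem comp {F G H : MedialFunctorData X Y} {α : TransData F G} {β : TransData G H}
    (hα : α.IsMedial) (hβ : β.IsMedial) : (α.comp β).IsMedial := by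
  constructor <;> intros <;>
    simp only [TransData.comp, NatTrans.comp_app, comp_tHom_id, id_tHom_comp, comp_pHom_id,
      id_pHom_comp, ← tHom_comp_tHom, ← pHom_comp_pHom, Category.assoc]
  case t_mTop => rw [reassoc_of% hα.t_mTop, hβ.t_mTop]
  case t_mTen => rw [reassoc_of% hα.t_mTen, hβ.t_mTen]
  case t_mBot => rw [reassoc_of% hα.t_mBot, hβ.t_mBot]
  case t_mPar => rw [reassoc_of% hα.t_mPar, hβ.t_mPar]
  case p_nBot => rw [hα.p_nBot, hβ.p_nBot]
  case p_nPar => rw [hα.p_nPar, reassoc_of% hβ.p_nPar]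
  case p_nTop => rw [hα.p_nTop, hβ.p_nTop]
  case p_nTen => rw [hα.p_nTen, reassoc_of% hβ.p_nTen]
  case νtR => rw [reassoc_of% hβ.νtR, pHom_exchange, reassoc_of% hα.νtR]
  case νtL => rw [reassoc_of% hβ.νtL, ← pHom_exchange, reassoc_of% hα.νtL]
  case νpL => rw [reassoc_of% hβ.νpL, reassoc_of% (@tHom_exchange), hα.νpL]
  case νpR => rw [reassoc_of% hβ.νpR, ← reassoc_of% (@tHom_exchange), hα.νpR]

theorem whiskerLeft (F : MedialFunctorData X Y) {G G' : MedialFunctorData Y Z}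
    {β : TransData G G'} (hβ : β.IsMedial) : (TransData.whiskerLeft F β).IsMedial := by
  constructor <;> intros <;>
    simp only [TransData.whiskerLeft, comp_toLinearFunctorData, comp_Ft, comp_Fp, comp_mTop,
      comp_mTen, comp_mBot, comp_mPar, comp_nTop, comp_nTen, comp_nBot, comp_nPar, comp_νtR,
      comp_νtL, comp_νpR, comp_νpL, Functor.whiskerLeft_app, Functor.comp_obj,
      NatTrans.naturality, ← NatTrans.naturality_assoc, Category.assoc]
  case t_mTop => rw [reassoc_of% hβ.t_mTop]
  case t_mTen => rw [reassoc_of% hβ.t_mTen]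
  case t_mBot => rw [reassoc_of% hβ.t_mBot]
  case t_mPar => rw [reassoc_of% hβ.t_mPar]
  case p_nBot => rw [hβ.p_nBot]
  case p_nPar => rw [hβ.p_nPar]
  case p_nTop => rw [hβ.p_nTop]
  case p_nTen => rw [hβ.p_nTen]
  case νtR => rw [hβ.νtR]
  case νtL => rw [hβ.νtL]
  case νpL => rw [reassoc_of% hβ.νpL]
  case νpR => rw [reassoc_of% hβ.νpR]

theorem whiskerRight {F F' : MedialFunctorData X Y} {α : TransData F F'} (hα : α.IsMedial)
    {G : MedialFunctorData Y Z} (hG : G.IsLinear) : (TransData.whiskerRight α G).IsMedial := by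
  constructor <;> intros <;>
    simp only [TransData.whiskerRight, comp_toLinearFunctorData, comp_Ft, comp_Fp, comp_mTop,
      comp_mTen, comp_mBot, comp_mPar, comp_nTop, comp_nTen, comp_nBot, comp_nPar, comp_νtR,
      comp_νtL, comp_νpR, comp_νpL, Functor.whiskerRight_app, Functor.comp_obj, Category.assoc]
  case t_mTop => rw [← Functor.map_comp, hα.t_mTop]
  case t_mTen =>
    rw [reassoc_of% (@G.mTen_natural)]
    simp only [← Functor.map_comp, hα.t_mTen]
  case t_mBot => rw [← Functor.map_comp, hα.t_mBot]
  case t_mPar =>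
    rw [reassoc_of% (@G.mPar_natural)]
    simp only [← Functor.map_comp, hα.t_mPar]
  case p_nBot => rw [← Functor.map_comp_assoc, hα.p_nBot]
  case p_nPar =>
    rw [← G.nPar_natural]
    simp only [← Functor.map_comp_assoc, hα.p_nPar]
  case p_nTop => rw [← Functor.map_comp_assoc, hα.p_nTop]
  case p_nTen =>
    rw [← G.nTen_natural]
    simp only [← Functor.map_comp_assoc, hα.p_nTen]
  case νtR =>
    rw [← hG.νtR_natural_left, ← hG.νtR_natural_right]
    simp only [← Functor.map_comp_assoc, hα.νtR]
  case νtL =>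
    rw [← hG.νtL_natural_left, ← hG.νtL_natural_right]
    simp only [← Functor.map_comp_assoc, hα.νtL]
  case νpL =>
    rw [reassoc_of% (@hG.νpL_natural_right), reassoc_of% (@hG.νpL_natural_left)]
    simp only [← Functor.map_comp, hα.νpL]
  case νpR =>
    rw [reassoc_of% (@hG.νpR_natural_left), reassoc_of% (@hG.νpR_natural_right)]
    simp only [← Functor.map_comp, hα.νpR]

end IsMedial

-- The `⊗`-components agree by definition; `hcomp` orders the two factors of the `⊕`-component
-- the other way round, so there naturality of `β` is needed.
theorem whiskerLeft_comp_whiskerRight {F F' : MedialFunctorData X Y} {G G' : MedialFunctorData Y Z}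
    (α : TransData F F') (β : TransData G G') :
    (whiskerLeft F β).comp (whiskerRight α G') = hcomp α β :=
  TransData.ext rfl (NatTrans.ext (funext fun A => β.p.naturality (α.p.app A)))

theorem IsMedial.hcomp {F F' : MedialFunctorData X Y} {α : TransData F F'} (hα : α.IsMedial)
    {G G' : MedialFunctorData Y Z} {β : TransData G G'} (hβ : β.IsMedial) (hG' : G'.IsLinear) :
    (TransData.hcomp α β).IsMedial :=
  whiskerLeft_comp_whiskerRight α β ▸ (hβ.whiskerLeft F).comp (hα.whiskerRight hG')

end TransData

namespace SMLDC

theorem isClosed : IsClosed.{v, u} where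
  id_functor X := MedialFunctorData.IsMedial.id X.carrier
  comp_functor F G := F.isMedial.comp G.isMedial
  id_trans F := TransData.IsMedial.id F.data
  comp_trans α β := α.isMedial.comp β.isMedial
  hcomp_trans {_ _ _ _ _ _ G'} α β := α.isMedial.hcomp β.isMedial G'.isMedial.isLinear
  whiskerLeft_trans F _ _ β := β.isMedial.whiskerLeft F.data
  whiskerRight_trans α G := α.isMedial.whiskerRight G.isMedial.isLinear

theorem eq_eqToHom (h : IsClosed.{v, u}) {X Y : SMLDC.{v, u}} {F F' : MedialLinearFunctor X Y}
    (e : F = F') (α : MedialLinearTransformation F F') (ht : α.data.t = eqToHom (by rw [e]))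
    (hp : α.data.p = eqToHom (by rw [e])) :
    α = @eqToHom _ (homCategory h X Y).toCategoryStruct _ _ e := by
  subst e
  exact MedialLinearTransformation.ext (TransData.ext ht hp)

theorem strict_bicategory (h : IsClosed.{v, u}) :
    @Bicategory.Strict SMLDC.{v, u} (bicategory h) :=
  letI := bicategory h
  { id_comp := fun F => MedialLinearFunctor.ext F.data.id_comp
    comp_id := fun F => MedialLinearFunctor.ext F.data.comp_id
    assoc := fun F G H => MedialLinearFunctor.ext (F.data.assoc G.data H.data)
    leftUnitor_eqToIso := fun F =>
      Iso.ext (eq_eqToHom h (MedialLinearFunctor.ext F.data.id_comp) _ rfl rfl)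
    rightUnitor_eqToIso := fun F =>
      Iso.ext (eq_eqToHom h (MedialLinearFunctor.ext F.data.comp_id) _ rfl rfl)
    associator_eqToIso := fun F G H =>
      Iso.ext (eq_eqToHom h (MedialLinearFunctor.ext (F.data.assoc G.data H.data)) _ rfl rfl) }

end SMLDC

end MedialLD

theorem mainTheorem4 :
    ∃ h : MedialLD.SMLDC.IsClosed.{v, u},
      letI : Bicategory.{max u v, max u v} MedialLD.SMLDC.{v, u} := MedialLD.SMLDC.bicategory h
      Bicategory.Strict MedialLD.SMLDC.{v, u} ∧
        ∀ {X Y Z : MedialLD.SMLDC.{v, u}} {F F' : X ⟶ Y} {G G' : Y ⟶ Z} (α : F ⟶ F') (β : G ⟶ G'),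
          Bicategory.whiskerLeft F β ≫ Bicategory.whiskerRight α G' =
            ⟨MedialLD.TransData.hcomp α.data β.data, h.hcomp_trans α β⟩ :=
  ⟨MedialLD.SMLDC.isClosed, MedialLD.SMLDC.strict_bicategory _, fun α β =>
    MedialLD.MedialLinearTransformation.ext
      (MedialLD.TransData.whiskerLeft_comp_whiskerRight α.data β.data)⟩
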